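/- Let $k$ be a field complete with respect to a non-trivial absolute value (Archimedean or non-Archimedean). Let $\mathrm{Ban}_k$ be the category of Banach spaces over $k$ (complete normed $k$-vector spaces, each with a specific norm) and bounded linear maps; if $k$ is non-Archimedean, norms are required to satisfy either the usual or the strong triangle inequality, one convention being fixed throughout, and the result holds for both. Let $V\hat\otimes W$ be the completed projective tensor product (the completion for $\|t\|=\inf\sum_i\|v_i\|\|w_i\|$, respectively $\inf\max_i\|v_i\|\|w_i\|$ in the convention of the strong triangle inequality, over all $t=\sum_i v_i\otimes w_i$), and $\underline{\mathrm{Hom}}(V,W)$ the Banach space of bounded linear maps. Let $\mathrm{IndBan}_k$ be the category of small filtered diagrams $X="\mathrm{colim}"_{i}X_i$ in $\mathrm{Ban}_k$, with $\mathrm{Hom}(X,Y)=\lim_i\mathrm{colim}_j\mathrm{Hom}(X_i,Y_j)$. It is complete, and closed symmetric monoidal for $$X\hat\otimes Y="\mathrm{colim}"_{i,j}X_i\hat\otimes Y_j,\qquad \underline{\mathrm{Hom}}(X,Y)=\lim_i"\mathrm{colim}"_j\underline{\mathrm{Hom}}(X_i,Y_j).$$ Let $\mathscr A$ be an IndBanach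 algebra, i.e. a (unital, associative) monoid object of $\mathrm{IndBan}_k$. Let $\mathcal C$ be the category of left $\mathscr A$-modules in $\mathrm{IndBan}_k$ and $F:\mathcal C\to\mathrm{IndBan}_k$ the forgetful functor. **Proposition.** The end $$\underline{\mathrm{Hom}}(F,F)=\int_{M\in\mathcal C}\underline{\mathrm{Hom}}(FM,FM)=\mathrm{eq}\Bigl(\prod_{M\in\mathcal C}\underline{\mathrm{Hom}}(FM,FM)\rightrightarrows\prod_{M\to M'}\underline{\mathrm{Hom}}(FM,FM')\Bigr)$$ (that is, the universal object with maps to all $\underline{\mathrm{Hom}}(FM,FM)$ compatible with all morphisms $M\to M'$ of $\mathcal C$) exists in $\mathrm{IndBan}_k$. Give it the IndBanach algebra structure whose unit has the identities as components, and whose multiplication is induced by the compositions $f\otimes g\mapsto f\circ g$ on the $\underline{\mathrm{Hom}}(FM,FM)$. Then $\mathscr A\cong\underline{\mathrm{Hom}}(F,F)$ as IndBanach algebras, through the canonical map whose component at $M$ is the map $\mathscr A\to\underline{\mathrm{Hom}}(FM,FM)$ corresponding to the action $\mathscr A\hat\otimes M\to M$. -/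

import Mathlib

open CategoryTheory MonoidalCategory Limits

universe v u

/-- An ind-object of `C`: a small filtered diagram in `C`, thought of as a formal colimit. -/
structure IndDiagram (C : Type u) [Category.{v} C] where
  Idx : Type v
  [cat : SmallCategory Idx]
  [filtered : IsFiltered Idx]
  diag : Idx ⥤ C

attribute [instance] IndDiagram.cat IndDiagram.filtered

namespace IndDiagram

section Basic

variable {C : Type u} [Category.{v} C]

/-- Two morphisms `c ⟶ Y j`, `c ⟶ Y j'` are identified when they agree at some later stage. -/
def germSetoid (c : C) (Y : IndDiagram.{v} C) : Setoid (Σ j : Y.Idx, c ⟶ Y.diag.obj j) where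
  r p q := ∃ (l : Y.Idx) (a : p.1 ⟶ l) (b : q.1 ⟶ l), p.2 ≫ Y.diag.map a = q.2 ≫ Y.diag.map b
  iseqv :=
    { refl := fun p => ⟨p.1, 𝟙 _, 𝟙 _, rfl⟩
      symm := fun ⟨l, a, b, h⟩ => ⟨l, b, a, h.symm⟩
      trans := by
        rintro ⟨i, f⟩ ⟨j, g⟩ ⟨k, h⟩ ⟨l, a, b, e⟩ ⟨l', a', b', e'⟩
        obtain ⟨m, s, t, hst⟩ := IsFiltered.span b a'
        refine ⟨m, a ≫ s, b' ≫ t, ?_⟩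
        dsimp only at e e' a b a' b' ⊢
        rw [Functor.map_comp, Functor.map_comp, ← Category.assoc, e, Category.assoc,
          ← Functor.map_comp, hst, Functor.map_comp, ← Category.assoc, e', Category.assoc] }

/-- `colim_j Hom(c, Y j)`. -/
def Germ (c : C) (Y : IndDiagram.{v} C) : Type v := Quotient (germSetoid c Y)

namespace Germ

/-- The class of a morphism `c ⟶ Y j` in `colim_j Hom(c, Y j)`. -/
def mk {c : C} {Y : IndDiagram.{v} C} (j : Y.Idx) (f : c ⟶ Y.diag.obj j) : Germ c Y :=
  Quotient.mk (germSetoid c Y) ⟨j, f⟩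

theorem exists_rep {c : C} {Y : IndDiagram.{v} C} (x : Germ c Y) :
    ∃ (j : Y.Idx) (f : c ⟶ Y.diag.obj j), x = mk j f := by
  obtain ⟨⟨j, f⟩, h⟩ := Quotient.exists_rep x
  exact ⟨j, f, h.symm⟩

theorem mk_eq_mk_iff {c : C} {Y : IndDiagram.{v} C} {j j' : Y.Idx} {f : c ⟶ Y.diag.obj j}
    {f' : c ⟶ Y.diag.obj j'} :
    mk j f = mk j' f' ↔
      ∃ (l : Y.Idx) (a : j ⟶ l) (b : j' ⟶ l), f ≫ Y.diag.map a = f' ≫ Y.diag.map b :=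
  Quotient.eq (r := germSetoid c Y)

theorem mk_map {c : C} {Y : IndDiagram.{v} C} {j j' : Y.Idx} (f : c ⟶ Y.diag.obj j) (a : j ⟶ j') :
    mk j' (f ≫ Y.diag.map a) = mk j f :=
  mk_eq_mk_iff.2 ⟨j', 𝟙 _, a, by simp⟩

/-- Precomposition `colim_j Hom(d, Y j) → colim_j Hom(c, Y j)`. -/
def pre {c d : C} {Y : IndDiagram.{v} C} (h : c ⟶ d) : Germ d Y → Germ c Y :=
  Quotient.lift (fun p => mk p.1 (h ≫ p.2)) (by
    rintro ⟨i, f⟩ ⟨j, g⟩ ⟨l, a, b, e⟩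
    exact mk_eq_mk_iff.2 ⟨l, a, b, by simpa using congrArg (h ≫ ·) e⟩)

@[simp] theorem pre_mk {c d : C} {Y : IndDiagram.{v} C} (h : c ⟶ d) (j : Y.Idx)
    (f : d ⟶ Y.diag.obj j) : pre h (mk j f) = mk j (h ≫ f) := rfl

@[simp] theorem pre_id {c : C} {Y : IndDiagram.{v} C} (x : Germ c Y) : pre (𝟙 c) x = x := by
  obtain ⟨j, f, rfl⟩ := x.exists_rep
  simp

theorem pre_pre {b c d : C} {Y : IndDiagram.{v} C} (g : b ⟶ c) (h : c ⟶ d) (x : Germ d Y) :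
    pre g (pre h x) = pre (g ≫ h) x := by
  obtain ⟨j, f, rfl⟩ := x.exists_rep
  simp

end Germ

/-- `Hom(X, Y) = lim_i colim_j Hom(X i, Y j)`: compatible families of germs. -/
@[ext]
structure Hom (X Y : IndDiagram.{v} C) where
  app : ∀ i : X.Idx, Germ (X.diag.obj i) Y
  compat : ∀ {i i' : X.Idx} (a : i ⟶ i'), (app i').pre (X.diag.map a) = app i

/-- Postcomposition of a germ with a morphism of ind-objects. -/
def Germ.post {c : C} {Y Z : IndDiagram.{v} C} (g : Hom Y Z) : Germ c Y → Germ c Z :=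
  Quotient.lift (fun p => (g.app p.1).pre p.2) (by
    rintro ⟨i, f⟩ ⟨j, f'⟩ ⟨l, a, b, e⟩
    dsimp only at e a b ⊢
    rw [← g.compat a, ← g.compat b, Germ.pre_pre, Germ.pre_pre, e])

@[simp] theorem Germ.post_mk {c : C} {Y Z : IndDiagram.{v} C} (g : Hom Y Z) (j : Y.Idx)
    (f : c ⟶ Y.diag.obj j) : Germ.post g (Germ.mk j f) = (g.app j).pre f := rfl

theorem Germ.post_pre {c d : C} {Y Z : IndDiagram.{v} C} (g : Hom Y Z) (h : c ⟶ d)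
    (x : Germ d Y) : Germ.post g (x.pre h) = (Germ.post g x).pre h := by
  obtain ⟨j, f, rfl⟩ := x.exists_rep
  simp [Germ.pre_pre]

/-- Composition: if `f_i` is represented by `φ : X i ⟶ Y j` and `g_j` by `ψ : Y j ⟶ Z k`, then
`(f ≫ g)_i` is represented by `φ ≫ ψ`. -/
instance : Category.{v} (IndDiagram.{v} C) where
  Hom X Y := Hom X Y
  id X :=
    { app := fun i => Germ.mk i (𝟙 _)
      compat := fun a => by
        rw [Germ.pre_mk, Category.comp_id, ← Germ.mk_map (𝟙 _) a, Category.id_comp] }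
  comp f g :=
    { app := fun i => Germ.post g (f.app i)
      compat := fun a => by rw [← Germ.post_pre, f.compat a] }
  id_comp f := by
    apply Hom.ext
    funext i
    simp
  comp_id f := by
    apply Hom.ext
    funext i
    dsimp only
    obtain ⟨j, φ, h⟩ := (f.app i).exists_rep
    rw [h]
    simp
  assoc f g h := by
    apply Hom.ext
    funext i
    dsimp only
    obtain ⟨j, φ, e⟩ := (f.app i).exists_rep
    rw [e]
    simp [Germ.post_pre]

theorem hom_ext {X Y : IndDiagram.{v} C} {f g : X ⟶ Y} (h : ∀ i, Hom.app f i = Hom.app g i) :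
    f = g :=
  Hom.ext (funext h)

@[simp] theorem id_app (X : IndDiagram.{v} C) (i : X.Idx) :
    Hom.app (𝟙 X) i = Germ.mk i (𝟙 _) := rfl

@[simp] theorem comp_app {X Y Z : IndDiagram.{v} C} (f : X ⟶ Y) (g : Y ⟶ Z) (i : X.Idx) :
    Hom.app (f ≫ g) i = Germ.post g (Hom.app f i) := rfl

theorem Germ.post_post {c : C} {X Y Z : IndDiagram.{v} C} (f : X ⟶ Y) (g : Y ⟶ Z)
    (x : Germ c X) : Germ.post g (Germ.post f x) = Germ.post (f ≫ g) x := by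
  obtain ⟨j, φ, rfl⟩ := x.exists_rep
  simp [Germ.post_pre]

@[simp] theorem Germ.post_id {c : C} {X : IndDiagram.{v} C} (x : Germ c X) :
    Germ.post (𝟙 X) x = x := by
  obtain ⟨j, φ, rfl⟩ := x.exists_rep
  simp

/-- A morphism of ind-objects given on representatives: `X i ⟶ Y (s i)`. -/
def homOfRep {X Y : IndDiagram.{v} C} (s : X.Idx → Y.Idx)
    (f : ∀ i, X.diag.obj i ⟶ Y.diag.obj (s i))
    (h : ∀ {i i' : X.Idx} (a : i ⟶ i'), Germ.mk (s i') (X.diag.map a ≫ f i') = Germ.mk (s i) (f i)) :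
    X ⟶ Y :=
  Hom.mk (fun i => Germ.mk (s i) (f i)) (fun a => h a)

@[simp] theorem homOfRep_app {X Y : IndDiagram.{v} C} (s : X.Idx → Y.Idx)
    (f : ∀ i, X.diag.obj i ⟶ Y.diag.obj (s i)) (h) (i : X.Idx) :
    Hom.app (homOfRep s f h) i = Germ.mk (s i) (f i) := rfl

/-- Isomorphic diagrams (through an equality of representatives) are isomorphic ind-objects. -/
def isoOfRep {X Y : IndDiagram.{v} C} (s : X.Idx → Y.Idx) (t : Y.Idx → X.Idx)
    (f : ∀ i, X.diag.obj i ⟶ Y.diag.obj (s i)) (g : ∀ j, Y.diag.obj j ⟶ X.diag.obj (t j))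
    (hf : ∀ {i i' : X.Idx} (a : i ⟶ i'), Germ.mk (s i') (X.diag.map a ≫ f i') = Germ.mk (s i) (f i))
    (hg : ∀ {i i' : Y.Idx} (a : i ⟶ i'), Germ.mk (t i') (Y.diag.map a ≫ g i') = Germ.mk (t i) (g i))
    (hfg : ∀ i, Germ.mk (t (s i)) (f i ≫ g (s i)) = Germ.mk i (𝟙 _))
    (hgf : ∀ j, Germ.mk (s (t j)) (g j ≫ f (t j)) = Germ.mk j (𝟙 _)) : X ≅ Y where
  hom := homOfRep s f hf
  inv := homOfRep t g hg
  hom_inv_id := hom_ext hfg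
  inv_hom_id := hom_ext hgf

@[simp] theorem isoOfRep_hom_app {X Y : IndDiagram.{v} C} (s : X.Idx → Y.Idx) (t : Y.Idx → X.Idx)
    (f : ∀ i, X.diag.obj i ⟶ Y.diag.obj (s i)) (g : ∀ j, Y.diag.obj j ⟶ X.diag.obj (t j))
    (hf) (hg) (hfg) (hgf) (i : X.Idx) :
    Hom.app (isoOfRep s t f g hf hg hfg hgf).hom i = Germ.mk (s i) (f i) := rfl

theorem Germ.mk_of_nat {X Y : IndDiagram.{v} C} {i i' : X.Idx} {j j' : Y.Idx}
    (a : i ⟶ i') (b : j ⟶ j') (f : X.diag.obj i ⟶ Y.diag.obj j)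
    (f' : X.diag.obj i' ⟶ Y.diag.obj j') (h : X.diag.map a ≫ f' = f ≫ Y.diag.map b) :
    Germ.mk j' (X.diag.map a ≫ f') = Germ.mk j f := by
  rw [h, Germ.mk_map]

end Basic

section Monoidal

variable {C : Type u} [Category.{v} C] [MonoidalCategory C]

/-- `("colim" X i) ⊗ ("colim" Y j) = "colim" (X i ⊗ Y j)`. -/
abbrev tensor (X Y : IndDiagram.{v} C) : IndDiagram.{v} C where
  Idx := X.Idx × Y.Idx
  diag :=
    { obj := fun p => X.diag.obj p.1 ⊗ Y.diag.obj p.2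
      map := fun a => X.diag.map a.1 ⊗ₘ Y.diag.map a.2 }

/-- The tensor product of germs. -/
def Germ.tens {c d : C} {X Y : IndDiagram.{v} C} :
    Germ c X → Germ d Y → Germ (c ⊗ d) (tensor X Y) :=
  Quotient.lift₂ (fun p q => Germ.mk (Y := tensor X Y) (p.1, q.1) (p.2 ⊗ₘ q.2)) (by
    rintro ⟨i, f⟩ ⟨j, g⟩ ⟨i', f'⟩ ⟨j', g'⟩ ⟨l, a, b, e⟩ ⟨l', a', b', e'⟩
    dsimp only at e e' a b a' b'
    refine Germ.mk_eq_mk_iff.2 ⟨(l, l'), (a, a'), (b, b'), ?_⟩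
    dsimp only
    rw [MonoidalCategory.tensorHom_comp_tensorHom, MonoidalCategory.tensorHom_comp_tensorHom, e, e'])

@[simp] theorem Germ.tens_mk {c d : C} {X Y : IndDiagram.{v} C} (i : X.Idx) (j : Y.Idx)
    (f : c ⟶ X.diag.obj i) (g : d ⟶ Y.diag.obj j) :
    Germ.tens (Germ.mk i f) (Germ.mk j g) = Germ.mk (Y := tensor X Y) (i, j) (f ⊗ₘ g) := rfl

theorem Germ.tens_pre {c c' d d' : C} {X Y : IndDiagram.{v} C} (h : c ⟶ c') (h' : d ⟶ d')
    (x : Germ c' X) (y : Germ d' Y) :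
    Germ.tens (x.pre h) (y.pre h') = (Germ.tens x y).pre (h ⊗ₘ h') := by
  obtain ⟨i, f, rfl⟩ := x.exists_rep
  obtain ⟨j, g, rfl⟩ := y.exists_rep
  simp only [Germ.pre_mk, Germ.tens_mk, MonoidalCategory.tensorHom_comp_tensorHom]

/-- The tensor product of morphisms of ind-objects. -/
def tensorMap {X Y X' Y' : IndDiagram.{v} C} (f : X ⟶ X') (g : Y ⟶ Y') :
    tensor X Y ⟶ tensor X' Y' :=
  Hom.mk (fun p => Germ.tens (Hom.app f p.1) (Hom.app g p.2)) (fun {i i'} a => by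
    rw [← Hom.compat f a.1, ← Hom.compat g a.2, Germ.tens_pre])

@[simp] theorem tensorMap_app {X Y X' Y' : IndDiagram.{v} C} (f : X ⟶ X') (g : Y ⟶ Y')
    (p : X.Idx × Y.Idx) :
    Hom.app (tensorMap f g) p = Germ.tens (Hom.app f p.1) (Hom.app g p.2) := rfl

/-- The unit: the constant singleton diagram. -/
abbrev unitObj : IndDiagram.{v} C where
  Idx := Discrete PUnit.{v + 1}
  diag :=
    { obj := fun _ => 𝟙_ C
      map := fun _ => 𝟙 _ }

instance : MonoidalCategoryStruct (IndDiagram.{v} C) where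
  tensorObj := tensor
  whiskerLeft X _ _ f := tensorMap (𝟙 X) f
  whiskerRight f Y := tensorMap f (𝟙 Y)
  tensorHom := tensorMap
  tensorUnit := unitObj
  associator X Y Z :=
    isoOfRep (X := tensor (tensor X Y) Z) (Y := tensor X (tensor Y Z))
      (fun p => (p.1.1, (p.1.2, p.2))) (fun p => ((p.1, p.2.1), p.2.2))
      (fun p => (α_ (X.diag.obj p.1.1) (Y.diag.obj p.1.2) (Z.diag.obj p.2)).hom)
      (fun p => (α_ (X.diag.obj p.1) (Y.diag.obj p.2.1) (Z.diag.obj p.2.2)).inv)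
      (fun a => Germ.mk_of_nat (X := tensor (tensor X Y) Z) (Y := tensor X (tensor Y Z))
        a (a.1.1, (a.1.2, a.2)) _ _ (by simp))
      (fun a => Germ.mk_of_nat (X := tensor X (tensor Y Z)) (Y := tensor (tensor X Y) Z)
        a ((a.1, a.2.1), a.2.2) _ _ (by simp))
      (fun _ => by simp) (fun _ => by simp)
  leftUnitor X :=
    isoOfRep (X := tensor unitObj X) (Y := X) (fun p => p.2) (fun i => (⟨⟨⟩⟩, i))
      (fun p => (λ_ (X.diag.obj p.2)).hom) (fun i => (λ_ (X.diag.obj i)).inv)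
      (fun a => Germ.mk_of_nat (X := tensor unitObj X) (Y := X) a a.2 _ _ (by simp))
      (fun a => Germ.mk_of_nat (X := X) (Y := tensor unitObj X) a (𝟙 (⟨⟨⟩⟩ : Discrete PUnit.{v + 1}), a) _ _ (by simp))
      (fun _ => by simp) (fun _ => by simp)
  rightUnitor X :=
    isoOfRep (X := tensor X unitObj) (Y := X) (fun p => p.1) (fun i => (i, ⟨⟨⟩⟩))
      (fun p => (ρ_ (X.diag.obj p.1)).hom) (fun i => (ρ_ (X.diag.obj i)).inv)
      (fun a => Germ.mk_of_nat (X := tensor X unitObj) (Y := X) a a.1 _ _ (by simp))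
      (fun a => Germ.mk_of_nat (X := X) (Y := tensor X unitObj) a (a, 𝟙 (⟨⟨⟩⟩ : Discrete PUnit.{v + 1})) _ _ (by simp))
      (fun _ => by simp) (fun _ => by simp)

@[simp] theorem tensorHom_app {X Y X' Y' : IndDiagram.{v} C} (f : X ⟶ X') (g : Y ⟶ Y')
    (p : X.Idx × Y.Idx) :
    Hom.app (f ⊗ₘ g) p = Germ.tens (Hom.app f p.1) (Hom.app g p.2) := rfl

theorem Germ.post_tens {c d : C} {X Y X' Y' : IndDiagram.{v} C} (f : X ⟶ X') (g : Y ⟶ Y')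
    (x : Germ c X) (y : Germ d Y) :
    Germ.post (f ⊗ₘ g) (Germ.tens x y) = Germ.tens (Germ.post f x) (Germ.post g y) := by
  obtain ⟨i, φ, rfl⟩ := x.exists_rep
  obtain ⟨j, ψ, rfl⟩ := y.exists_rep
  exact (Germ.tens_pre φ ψ _ _).symm

theorem Germ.post_associator {b c d : C} {X Y Z : IndDiagram.{v} C} (x : Germ b X) (y : Germ c Y)
    (z : Germ d Z) :
    Germ.post (α_ X Y Z).hom (Germ.tens (Germ.tens x y) z) =
      (Germ.tens x (Germ.tens y z)).pre (α_ b c d).hom := by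
  obtain ⟨i, f, rfl⟩ := x.exists_rep
  obtain ⟨j, g, rfl⟩ := y.exists_rep
  obtain ⟨k, h, rfl⟩ := z.exists_rep
  exact congrArg (Germ.mk (Y := tensor X (tensor Y Z)) (i, (j, k)))
    (MonoidalCategory.associator_naturality f g h)

theorem Germ.post_leftUnitor {c : C} {X : IndDiagram.{v} C} (x : Germ c X) :
    Germ.post (λ_ X).hom (Germ.tens (Germ.mk (Y := unitObj) ⟨⟨⟩⟩ (𝟙 (𝟙_ C))) x) =
      x.pre (λ_ c).hom := by
  obtain ⟨i, f, rfl⟩ := x.exists_rep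
  exact congrArg (Germ.mk (Y := X) i) (by simp)

theorem Germ.post_rightUnitor {c : C} {X : IndDiagram.{v} C} (x : Germ c X) :
    Germ.post (ρ_ X).hom (Germ.tens x (Germ.mk (Y := unitObj) ⟨⟨⟩⟩ (𝟙 (𝟙_ C)))) =
      x.pre (ρ_ c).hom := by
  obtain ⟨i, f, rfl⟩ := x.exists_rep
  exact congrArg (Germ.mk (Y := X) i) (by simp)

/-- The monoidal structure on ind-objects. -/
instance : MonoidalCategory (IndDiagram.{v} C) :=
  MonoidalCategory.ofTensorHom
    (id_tensorHom_id := fun X Y => hom_ext fun p => congrArg (Germ.mk (Y := tensor X Y) p)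
      (MonoidalCategory.id_tensorHom_id _ _))
    (id_tensorHom := fun _ _ _ _ => rfl)
    (tensorHom_id := fun _ _ => rfl)
    (tensorHom_comp_tensorHom := fun f₁ f₂ g₁ g₂ => hom_ext fun p => Germ.post_tens _ _ _ _)
    (associator_naturality := fun {X₁ X₂ X₃ Y₁ Y₂ Y₃} f₁ f₂ f₃ => hom_ext fun p =>
      Germ.post_associator (Hom.app f₁ p.1.1) (Hom.app f₂ p.1.2) (Hom.app f₃ p.2))
    (leftUnitor_naturality := fun f => hom_ext fun p => Germ.post_leftUnitor (Hom.app f p.2))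
    (rightUnitor_naturality := fun f => hom_ext fun p => Germ.post_rightUnitor (Hom.app f p.1))
    (pentagon := fun W X Y Z => hom_ext fun p =>
      congrArg (Germ.mk (Y := tensor W (tensor X (tensor Y Z))) (p.1.1.1, (p.1.1.2, (p.1.2, p.2))))
        (by simp; exact MonoidalCategory.pentagon _ _ _ _))
    (triangle := fun X Y => hom_ext fun p =>
      congrArg (Germ.mk (Y := tensor X Y) (p.1.1, p.2)) (by simp; exact MonoidalCategory.triangle _ _))

end Monoidal

section Braided

variable {C : Type u} [Category.{v} C] [MonoidalCategory C] [SymmetricCategory C]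

/-- The symmetry of the tensor product of ind-objects. -/
def braid (X Y : IndDiagram.{v} C) : X ⊗ Y ≅ Y ⊗ X :=
  isoOfRep (X := tensor X Y) (Y := tensor Y X) (fun p => (p.2, p.1)) (fun p => (p.2, p.1))
    (fun p => (β_ (X.diag.obj p.1) (Y.diag.obj p.2)).hom)
    (fun p => (β_ (Y.diag.obj p.1) (X.diag.obj p.2)).hom)
    (fun a => Germ.mk_of_nat (X := tensor X Y) (Y := tensor Y X) a (a.2, a.1) _ _ (by simp))
    (fun a => Germ.mk_of_nat (X := tensor Y X) (Y := tensor X Y) a (a.2, a.1) _ _ (by simp))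
    (fun _ => by simp) (fun _ => by simp)

theorem Germ.post_braid {c d : C} {X Y : IndDiagram.{v} C} (x : Germ c X) (y : Germ d Y) :
    Germ.post (braid X Y).hom (Germ.tens x y) = (Germ.tens y x).pre (β_ c d).hom := by
  obtain ⟨i, f, rfl⟩ := x.exists_rep
  obtain ⟨j, g, rfl⟩ := y.exists_rep
  exact congrArg (Germ.mk (Y := tensor Y X) (j, i)) (BraidedCategory.braiding_naturality f g)

instance : SymmetricCategory (IndDiagram.{v} C) where
  braiding := braid
  braiding_naturality_right X _ _ f := hom_ext fun p =>
    Germ.post_braid (Hom.app (𝟙 X) p.1) (Hom.app f p.2)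
  braiding_naturality_left f Z := hom_ext fun p =>
    Germ.post_braid (Hom.app f p.1) (Hom.app (𝟙 Z) p.2)
  hexagon_forward X Y Z := hom_ext fun p =>
    congrArg (Germ.mk (Y := tensor Y (tensor Z X)) (p.1.2, (p.2, p.1.1)))
      (by simp; exact BraidedCategory.hexagon_forward _ _ _)
  hexagon_reverse X Y Z := hom_ext fun p =>
    congrArg (Germ.mk (Y := tensor (tensor Z X) Y) ((p.2.2, p.1), p.2.1))
      (by simp; exact BraidedCategory.hexagon_reverse _ _ _)
  symmetry X Y := (braid X Y).hom_inv_id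

end Braided

end IndDiagram

namespace IndDiagram

section Closed

variable {C : Type u} [Category.{v} C] [MonoidalCategory C] [MonoidalClosed C]

/-- `"colim"_j [c, Y j]` for `c` in `C`, where `[-, -]` is the internal hom of `C`. -/
abbrev level (c : C) (Y : IndDiagram.{v} C) : IndDiagram.{v} C where
  Idx := Y.Idx
  diag := Y.diag ⋙ ihom c

/-- Contravariant functoriality of `"colim"_j [c, Y j]` in `c`. -/
def levelMap {c d : C} (h : c ⟶ d) (Y : IndDiagram.{v} C) : level d Y ⟶ level c Y :=
  homOfRep (X := level d Y) (Y := level c Y) (fun j => j)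
    (fun j => (MonoidalClosed.pre h).app (Y.diag.obj j))
    (fun a => Germ.mk_of_nat (X := level d Y) (Y := level c Y) a a _ _
      ((MonoidalClosed.pre h).naturality (Y.diag.map a)))

/-- The inverse system `i ↦ "colim"_j [X i, Y j]`. -/
def ihomDiagram (X Y : IndDiagram.{v} C) : X.Idxᵒᵖ ⥤ IndDiagram.{v} C where
  obj i := level (X.diag.obj i.unop) Y
  map a := levelMap (X.diag.map a.unop) Y
  map_id i := hom_ext fun j => congrArg (Germ.mk (Y := level (X.diag.obj i.unop) Y) j) (by simp)
  map_comp {i₁ i₂ i₃} a b := hom_ext fun j =>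
    congrArg (Germ.mk (Y := level (X.diag.obj i₃.unop) Y) j) (by simp)

/-- Currying of germs. -/
def Germ.curry {c d : C} {Y : IndDiagram.{v} C} : Germ (c ⊗ d) Y → Germ d (level c Y) :=
  Quotient.lift (fun p => Germ.mk (Y := level c Y) p.1 (MonoidalClosed.curry p.2)) (by
    rintro ⟨i, f⟩ ⟨j, g⟩ ⟨l, a, b, e⟩
    refine Germ.mk_eq_mk_iff.2 ⟨l, a, b, ?_⟩
    exact (MonoidalClosed.curry_natural_right _ _).symm.trans
      ((congrArg MonoidalClosed.curry e).trans (MonoidalClosed.curry_natural_right _ _)))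

/-- Uncurrying of germs. -/
def Germ.uncurry {c d : C} {Y : IndDiagram.{v} C} : Germ d (level c Y) → Germ (c ⊗ d) Y :=
  Quotient.lift (fun p => Germ.mk (Y := Y) p.1 (MonoidalClosed.uncurry p.2)) (by
    rintro ⟨i, f⟩ ⟨j, g⟩ ⟨l, a, b, e⟩
    refine Germ.mk_eq_mk_iff.2 ⟨l, a, b, ?_⟩
    exact (MonoidalClosed.uncurry_natural_right _ _).symm.trans
      ((congrArg MonoidalClosed.uncurry e).trans (MonoidalClosed.uncurry_natural_right _ _)))

theorem Germ.uncurry_curry {c d : C} {Y : IndDiagram.{v} C} (x : Germ (c ⊗ d) Y) :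
    Germ.uncurry (Germ.curry x) = x := by
  obtain ⟨j, f, rfl⟩ := x.exists_rep
  exact congrArg (Germ.mk j) (MonoidalClosed.uncurry_curry f)

theorem Germ.curry_uncurry {c d : C} {Y : IndDiagram.{v} C} (x : Germ d (level c Y)) :
    Germ.curry (Germ.uncurry x) = x := by
  obtain ⟨j, f, rfl⟩ := x.exists_rep
  exact congrArg (Germ.mk (Y := level c Y) j) (MonoidalClosed.curry_uncurry f)

theorem Germ.curry_pre {c c' d d' : C} {Y : IndDiagram.{v} C} (h : c ⟶ c') (k : d ⟶ d')
    (x : Germ (c' ⊗ d') Y) :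
    Germ.curry (x.pre (h ⊗ₘ k)) = Germ.post (levelMap h Y) ((Germ.curry x).pre k) := by
  obtain ⟨j, f, rfl⟩ := x.exists_rep
  refine congrArg (Germ.mk (Y := level c Y) j) ?_
  dsimp only
  rw [MonoidalCategory.tensorHom_def', Category.assoc, MonoidalClosed.curry_natural_left,
    Category.assoc, MonoidalClosed.curry_pre_app]

theorem Germ.curry_pre_left {c c' d : C} {Y : IndDiagram.{v} C} (h : c ⟶ c')
    (x : Germ (c' ⊗ d) Y) :
    Germ.curry (x.pre (h ⊗ₘ 𝟙 d)) = Germ.post (levelMap h Y) (Germ.curry x) := by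
  rw [Germ.curry_pre, Germ.pre_id]

theorem Germ.curry_pre_right {c d d' : C} {Y : IndDiagram.{v} C} (k : d ⟶ d')
    (x : Germ (c ⊗ d') Y) :
    Germ.curry (x.pre (𝟙 c ⊗ₘ k)) = (Germ.curry x).pre k := by
  obtain ⟨j, f, rfl⟩ := x.exists_rep
  refine congrArg (Germ.mk (Y := level c Y) j) ?_
  dsimp only
  rw [MonoidalCategory.id_tensorHom, MonoidalClosed.curry_natural_left]

theorem Germ.uncurry_pre {c c' d d' : C} {Y : IndDiagram.{v} C} (h : c ⟶ c') (k : d ⟶ d')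
    (x : Germ d' (level c' Y)) :
    Germ.uncurry (Germ.post (levelMap h Y) (x.pre k)) = (Germ.uncurry x).pre (h ⊗ₘ k) := by
  rw [← Germ.curry_uncurry x, ← Germ.curry_pre, Germ.uncurry_curry, Germ.uncurry_curry]

variable [HasLimitsOfSize.{v, v} (IndDiagram.{v} C)]

/-- `["colim" X i, "colim" Y j] = lim_i "colim"_j [X i, Y j]`. -/
noncomputable def ihomObj (X Y : IndDiagram.{v} C) : IndDiagram.{v} C := limit (ihomDiagram X Y)

/-- The projection `[X, Y] ⟶ "colim"_j [X i, Y j]`. -/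
noncomputable def ihomπ (X Y : IndDiagram.{v} C) (i : X.Idx) :
    ihomObj X Y ⟶ level (X.diag.obj i) Y :=
  limit.π (ihomDiagram X Y) (Opposite.op i)

theorem ihomπ_comp (X Y : IndDiagram.{v} C) {i i' : X.Idx} (a : i ⟶ i') :
    ihomπ X Y i' ≫ levelMap (X.diag.map a) Y = ihomπ X Y i :=
  limit.w (ihomDiagram X Y) a.op

/-- The component `Z ⟶ "colim"_j [X i, Y j]` of the transpose of `X ⊗ Z ⟶ Y`. -/
def transposeComponent {X Z Y : IndDiagram.{v} C} (f : X ⊗ Z ⟶ Y) (i : X.Idx) :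
    Z ⟶ level (X.diag.obj i) Y :=
  Hom.mk (fun z => Germ.curry (Hom.app f (i, z))) (fun {z z'} a => by
    rw [← Hom.compat f (i := (i, z)) (i' := (i, z')) (𝟙 i, a), ← Germ.curry_pre_right]
    exact congrArg (fun t => Germ.curry (Germ.pre (t ⊗ₘ Z.diag.map a) (Hom.app f (i, z'))))
      (X.diag.map_id i).symm)

/-- The transpose `Z ⟶ [X, Y]` of `X ⊗ Z ⟶ Y`. -/
noncomputable def transpose {X Z Y : IndDiagram.{v} C} (f : X ⊗ Z ⟶ Y) : Z ⟶ ihomObj X Y :=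
  limit.lift (ihomDiagram X Y)
    { pt := Z
      π :=
        { app := fun i => transposeComponent f i.unop
          naturality := fun i i' a => by
            refine (Category.id_comp _).trans (hom_ext fun z => ?_)
            refine Eq.trans ?_ (Germ.curry_pre_left (X.diag.map a.unop) (Hom.app f (i.unop, z)))
            refine congrArg Germ.curry ?_
            refine (Hom.compat f (i := (i'.unop, z)) (i' := (i.unop, z)) (a.unop, 𝟙 z)).symm.trans ?_
            exact congrArg (fun t => Germ.pre (X.diag.map a.unop ⊗ₘ t) (Hom.app f (i.unop, z)))
              (Z.diag.map_id z) } }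

theorem transpose_π {X Z Y : IndDiagram.{v} C} (f : X ⊗ Z ⟶ Y) (i : X.Idx) :
    transpose f ≫ ihomπ X Y i = transposeComponent f i :=
  limit.lift_π _ _

/-- The inverse of `transpose`. -/
noncomputable def untranspose {X Z Y : IndDiagram.{v} C} (g : Z ⟶ ihomObj X Y) : X ⊗ Z ⟶ Y :=
  Hom.mk (fun p => Germ.uncurry
      (Hom.app (g ≫ ihomπ X Y p.1) p.2)) (fun {p p'} a => by
    refine (Germ.uncurry_pre (X.diag.map a.1) (Z.diag.map a.2) _).symm.trans ?_
    refine congrArg Germ.uncurry ?_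
    rw [← ihomπ_comp X Y a.1, Hom.compat _ a.2, ← Category.assoc, comp_app (g ≫ _)])

/-- The bijection `Hom(X ⊗ Z, Y) ≃ Hom(Z, [X, Y])`. -/
noncomputable def transposeEquiv (X Z Y : IndDiagram.{v} C) :
    (X ⊗ Z ⟶ Y) ≃ (Z ⟶ ihomObj X Y) where
  toFun := transpose
  invFun := untranspose
  left_inv f := hom_ext fun p =>
    (congrArg (fun t => Germ.uncurry (Hom.app t p.2)) (transpose_π f p.1)).trans
      (Germ.uncurry_curry _)
  right_inv _ := limit.hom_ext fun i => (transpose_π _ i.unop).trans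
    (hom_ext fun _ => Germ.curry_uncurry _)

theorem transpose_naturality {X Z' Z Y : IndDiagram.{v} C} (f : Z' ⟶ Z) (g : X ⊗ Z ⟶ Y) :
    transpose (X ◁ f ≫ g) = f ≫ transpose g := by
  refine limit.hom_ext fun i => (transpose_π _ i.unop).trans ?_
  refine Eq.trans (hom_ext fun z => ?_)
    ((congrArg (f ≫ ·) (transpose_π g i.unop)).symm.trans (Category.assoc _ _ _).symm)
  change Germ.curry (Germ.post g (Germ.tens (Germ.mk i.unop (𝟙 _)) (Hom.app f z))) =
    Germ.post (transposeComponent g i.unop) (Hom.app f z)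
  obtain ⟨w, φ, e⟩ := (Hom.app f z).exists_rep
  rw [e]
  exact Germ.curry_pre_right φ (Hom.app g (i.unop, w))

/-- The closed structure on ind-objects. -/
noncomputable instance : MonoidalClosed (IndDiagram.{v} C) where
  closed X :=
    { rightAdj := Adjunction.rightAdjointOfEquiv (F := tensorLeft X)
        (fun Z Y => transposeEquiv X Z Y) (fun _ _ _ f g => transpose_naturality f g)
      adj := Adjunction.adjunctionOfEquivRight (F := tensorLeft X)
        (fun Z Y => transposeEquiv X Z Y) (fun _ _ _ f g => transpose_naturality f g) }

end Closed

end IndDiagram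

/-- The notion of Banach space over `k`: norms satisfying the usual triangle inequality, or, over a
non-Archimedean field, norms satisfying the strong triangle inequality. -/
inductive BanachConvention (k : Type u) [NontriviallyNormedField k] : Type u
  | archimedean : BanachConvention k
  | nonarchimedean (h : IsUltrametricDist k) : BanachConvention k

namespace BanachConvention

variable {k : Type u} [NontriviallyNormedField k]

/-- The right-hand side of the triangle inequality: `a + b` or `max a b`. -/
def op : BanachConvention k → ℝ → ℝ → ℝ
  | archimedean => fun a b => a + b
  | nonarchimedean _ => fun a b => max a b

/-- The triangle inequality of the convention. -/
def Admissible (c : BanachConvention k) (V : Type*) [SeminormedAddCommGroup V] : Prop :=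
  ∀ x y : V, ‖x + y‖ ≤ c.op ‖x‖ ‖y‖

variable (c : BanachConvention k)

theorem op_le_add {a b : ℝ} (ha : 0 ≤ a) (hb : 0 ≤ b) : c.op a b ≤ a + b := by
  cases c with
  | archimedean => exact le_rfl
  | nonarchimedean h => exact max_le (by linarith) (by linarith)

theorem op_nonneg {a b : ℝ} (ha : 0 ≤ a) (hb : 0 ≤ b) : 0 ≤ c.op a b := by
  cases c with
  | archimedean => exact add_nonneg ha hb
  | nonarchimedean h => exact le_max_of_le_left ha

theorem op_mono {a b a' b' : ℝ} (ha : a ≤ a') (hb : b ≤ b') : c.op a b ≤ c.op a' b' := by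
  cases c with
  | archimedean => exact add_le_add ha hb
  | nonarchimedean h => exact max_le_max ha hb

theorem op_assoc (x y z : ℝ) : c.op (c.op x y) z = c.op x (c.op y z) := by
  cases c with
  | archimedean => exact add_assoc _ _ _
  | nonarchimedean h => exact max_assoc _ _ _

theorem op_zero_left {a : ℝ} (ha : 0 ≤ a) : c.op 0 a = a := by
  cases c with
  | archimedean => exact zero_add _
  | nonarchimedean h => exact max_eq_right ha

theorem mul_op {r : ℝ} (hr : 0 ≤ r) (a b : ℝ) : r * c.op a b = c.op (r * a) (r * b) := by
  cases c with
  | archimedean => exact mul_add _ _ _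
  | nonarchimedean h => exact mul_max_of_nonneg _ _ hr

theorem op_add_le {a b e : ℝ} (he : 0 ≤ e) : c.op (a + e) (b + e) ≤ c.op a b + 2 * e := by
  cases c with
  | archimedean => simp only [op]; linarith
  | nonarchimedean h =>
    simp only [op]
    rw [max_add_add_right]
    linarith

theorem continuous_op : Continuous fun p : ℝ × ℝ => c.op p.1 p.2 := by
  cases c with
  | archimedean => exact continuous_add
  | nonarchimedean h => exact continuous_fst.max continuous_snd

theorem admissible_field : c.Admissible k := by
  cases c with
  | archimedean => exact norm_add_le
  | nonarchimedean h => exact IsUltrametricDist.norm_add_le_max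

end BanachConvention

section PreTensor

variable {k : Type u} [NontriviallyNormedField k] (c : BanachConvention k)
variable (V W : Type u) [NormedAddCommGroup V] [NormedSpace k V]
  [NormedAddCommGroup W] [NormedSpace k W]

open scoped TensorProduct in
/-- The algebraic tensor product, to be equipped with the projective seminorm. -/
def PreTensor (_c : BanachConvention k) (V W : Type u) [NormedAddCommGroup V] [NormedSpace k V]
    [NormedAddCommGroup W] [NormedSpace k W] : Type u := V ⊗[k] W

namespace PreTensor

open scoped TensorProduct in
instance : AddCommGroup (PreTensor c V W) := inferInstanceAs (AddCommGroup (V ⊗[k] W))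

open scoped TensorProduct in
instance : Module k (PreTensor c V W) := inferInstanceAs (Module k (V ⊗[k] W))

/-- The canonical bilinear map to the tensor product. -/
def tmul : V →ₗ[k] W →ₗ[k] PreTensor c V W := TensorProduct.mk k V W

variable {V W}

/-- The element `∑ vᵢ ⊗ wᵢ`. -/
def val (l : List (V × W)) : PreTensor c V W := (l.map fun p => tmul c V W p.1 p.2).sum

/-- `∑ ‖vᵢ‖ ‖wᵢ‖`, or `max ‖vᵢ‖ ‖wᵢ‖` in the non-Archimedean convention. -/
def cost (l : List (V × W)) : ℝ := l.foldr (fun p s => c.op (‖p.1‖ * ‖p.2‖) s) 0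

theorem cost_nonneg (l : List (V × W)) : 0 ≤ cost c l := by
  induction l with
  | nil => exact le_rfl
  | cons p l ih => exact c.op_nonneg (by positivity) ih

theorem val_append (l l' : List (V × W)) : val c (l ++ l') = val c l + val c l' := by
  simp [val]

theorem cost_append (l l' : List (V × W)) : cost c (l ++ l') = c.op (cost c l) (cost c l') := by
  induction l with
  | nil => exact (c.op_zero_left (cost_nonneg c l')).symm
  | cons p l ih =>
    change c.op _ (cost c (l ++ l')) = c.op (c.op _ (cost c l)) _
    rw [ih, c.op_assoc]

theorem val_smul (a : k) (l : List (V × W)) :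
    val c (l.map fun p => (a • p.1, p.2)) = a • val c l := by
  induction l with
  | nil => simp [val]
  | cons p l ih =>
    simp only [val, List.map_cons, List.sum_cons, smul_add, map_smul, LinearMap.smul_apply] at ih ⊢
    rw [ih]

theorem cost_smul (a : k) (l : List (V × W)) :
    cost c (l.map fun p => (a • p.1, p.2)) = ‖a‖ * cost c l := by
  induction l with
  | nil => simp [cost]
  | cons p l ih =>
    change c.op (‖a • p.1‖ * ‖p.2‖) (cost c (l.map fun p => (a • p.1, p.2))) =
      ‖a‖ * c.op (‖p.1‖ * ‖p.2‖) (cost c l)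
    rw [ih, c.mul_op (norm_nonneg a), norm_smul, mul_assoc]

theorem exists_val (t : PreTensor c V W) : ∃ l : List (V × W), val c l = t := by
  refine TensorProduct.induction_on (motive := fun t : PreTensor c V W => ∃ l, val c l = t) t
    ⟨[], rfl⟩ (fun v w => ⟨[(v, w)], ?_⟩) ?_
  · exact (by simp [val, tmul] : val c [(v, w)] = tmul c V W v w)
  · rintro _ _ ⟨l, rfl⟩ ⟨l', rfl⟩
    exact ⟨l ++ l', val_append c l l'⟩

/-- The projective seminorm: the infimum of `∑ ‖vᵢ‖ ‖wᵢ‖` (or `max ‖vᵢ‖ ‖wᵢ‖`) over all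
representations `t = ∑ vᵢ ⊗ wᵢ`. -/
noncomputable def projNorm (t : PreTensor c V W) : ℝ :=
  sInf {r : ℝ | ∃ l : List (V × W), val c l = t ∧ cost c l = r}

theorem projNorm_le (l : List (V × W)) : projNorm c (val c l) ≤ cost c l :=
  csInf_le ⟨0, by rintro _ ⟨l, -, rfl⟩; exact cost_nonneg c l⟩ ⟨l, rfl, rfl⟩

theorem projNorm_nonneg (t : PreTensor c V W) : 0 ≤ projNorm c t :=
  Real.sInf_nonneg (by rintro _ ⟨l, -, rfl⟩; exact cost_nonneg c l)

theorem exists_cost_lt (t : PreTensor c V W) {r : ℝ} (h : projNorm c t < r) :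
    ∃ l : List (V × W), val c l = t ∧ cost c l < r := by
  obtain ⟨l, hl⟩ := exists_val c t
  have hne : {r : ℝ | ∃ l : List (V × W), val c l = t ∧ cost c l = r}.Nonempty :=
    ⟨cost c l, l, hl, rfl⟩
  obtain ⟨_, ⟨l', h', rfl⟩, hr⟩ := exists_lt_of_csInf_lt hne h
  exact ⟨l', h', hr⟩

theorem projNorm_add (s t : PreTensor c V W) :
    projNorm c (s + t) ≤ c.op (projNorm c s) (projNorm c t) := by
  refine le_of_forall_pos_le_add fun e he => ?_
  obtain ⟨l, rfl, hl⟩ := exists_cost_lt c s (lt_add_of_pos_right _ (half_pos he))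
  obtain ⟨l', rfl, hl'⟩ := exists_cost_lt c t (lt_add_of_pos_right _ (half_pos he))
  rw [← val_append]
  refine (projNorm_le c _).trans ?_
  rw [cost_append]
  refine (c.op_mono hl.le hl'.le).trans ((c.op_add_le (half_pos he).le).trans ?_)
  linarith

theorem projNorm_smul_le (a : k) (t : PreTensor c V W) :
    projNorm c (a • t) ≤ ‖a‖ * projNorm c t := by
  refine le_of_forall_pos_le_add fun e he => ?_
  obtain ⟨l, rfl, hl⟩ := exists_cost_lt c t (lt_add_of_pos_right _
    (div_pos he (show (0 : ℝ) < ‖a‖ + 1 by positivity)))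
  rw [← val_smul]
  refine (projNorm_le c _).trans ?_
  rw [cost_smul]
  refine (mul_le_mul_of_nonneg_left hl.le (norm_nonneg a)).trans ?_
  rw [mul_add]
  have h : ‖a‖ * (e / (‖a‖ + 1)) ≤ e := by
    rw [mul_div_assoc', div_le_iff₀ (by positivity)]
    nlinarith [norm_nonneg a]
  linarith

noncomputable instance : SeminormedAddCommGroup (PreTensor c V W) :=
  AddGroupSeminorm.toSeminormedAddCommGroup
    { toFun := projNorm c
      map_zero' := le_antisymm (projNorm_le c []) (projNorm_nonneg c _)
      add_le' := fun s t => (projNorm_add c s t).trans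
        (c.op_le_add (projNorm_nonneg c _) (projNorm_nonneg c _))
      neg' := fun t => by
        have h : ∀ t : PreTensor c V W, projNorm c (-t) ≤ projNorm c t := fun t => by
          simpa using projNorm_smul_le c (-1 : k) t
        exact le_antisymm (h t) (by simpa using h (-t)) }

theorem norm_def (t : PreTensor c V W) : ‖t‖ = projNorm c t := rfl

noncomputable instance : NormedSpace k (PreTensor c V W) where
  norm_smul_le := projNorm_smul_le c

theorem norm_tmul_le (v : V) (w : W) : ‖tmul c V W v w‖ ≤ ‖v‖ * ‖w‖ := by
  have h := projNorm_le c [(v, w)]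
  have h' : cost c [(v, w)] ≤ ‖v‖ * ‖w‖ := by
    have := c.op_le_add (a := ‖v‖ * ‖w‖) (b := 0) (by positivity) le_rfl
    simpa [cost] using this
  have e : val c [(v, w)] = tmul c V W v w := by simp [val]
  rw [e] at h
  exact h.trans h'

/-- The linear map induced by a bounded bilinear map to an admissible space. -/
noncomputable def liftAux {Z : Type u} [NormedAddCommGroup Z] [NormedSpace k Z]
    (hZ : c.Admissible Z) (f : V →L[k] W →L[k] Z) : PreTensor c V W →L[k] Z :=
  LinearMap.mkContinuous (E := PreTensor c V W)
    (TensorProduct.lift ((ContinuousLinearMap.coeLM k).comp f.toLinearMap) :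
      PreTensor c V W →ₗ[k] Z) ‖f‖ (by
    intro t
    set F : PreTensor c V W →ₗ[k] Z :=
      TensorProduct.lift ((ContinuousLinearMap.coeLM k).comp f.toLinearMap) with hF
    have key : ∀ l : List (V × W), ‖F (val c l)‖ ≤ ‖f‖ * cost c l := by
      intro l
      induction l with
      | nil => simp [val, cost]
      | cons p l ih =>
        have e : val c (p :: l) = tmul c V W p.1 p.2 + val c l := by simp [val]
        have e' : F (tmul c V W p.1 p.2) = f p.1 p.2 := TensorProduct.lift.tmul _ _
        rw [e, map_add, e']
        refine (hZ _ _).trans ?_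
        change _ ≤ ‖f‖ * c.op (‖p.1‖ * ‖p.2‖) (cost c l)
        rw [c.mul_op (norm_nonneg f), ← mul_assoc]
        exact c.op_mono (f.le_opNorm₂ p.1 p.2) ih
    refine le_of_forall_pos_le_add fun e he => ?_
    obtain ⟨l, rfl, hl⟩ := exists_cost_lt c t (lt_add_of_pos_right _
      (div_pos he (show (0 : ℝ) < ‖f‖ + 1 by positivity)))
    refine (key l).trans ((mul_le_mul_of_nonneg_left hl.le (norm_nonneg f)).trans ?_)
    rw [mul_add]
    have h : ‖f‖ * (e / (‖f‖ + 1)) ≤ e := by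
      rw [mul_div_assoc', div_le_iff₀ (by positivity)]
      nlinarith [norm_nonneg f]
    exact add_le_add_right h _)

theorem liftAux_tmul {Z : Type u} [NormedAddCommGroup Z] [NormedSpace k Z]
    (hZ : c.Admissible Z) (f : V →L[k] W →L[k] Z) (v : V) (w : W) :
    liftAux c hZ f (tmul c V W v w) = f v w := TensorProduct.lift.tmul _ _

theorem norm_liftAux_le {Z : Type u} [NormedAddCommGroup Z] [NormedSpace k Z]
    (hZ : c.Admissible Z) (f : V →L[k] W →L[k] Z) : ‖liftAux c hZ f‖ ≤ ‖f‖ :=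
  LinearMap.mkContinuous_norm_le _ (norm_nonneg f) _

/-- Continuous linear maps on the tensor product are determined by elementary tensors. -/
theorem clm_ext {Z : Type u} [NormedAddCommGroup Z] [NormedSpace k Z]
    {f g : PreTensor c V W →L[k] Z} (h : ∀ v w, f (tmul c V W v w) = g (tmul c V W v w)) :
    f = g :=
  ContinuousLinearMap.coe_injective (TensorProduct.ext (LinearMap.ext₂ h))

end PreTensor

end PreTensor

/-- Objects of `Ban_k`: Banach spaces over `k`, each equipped with a specific norm. -/
structure Ban {k : Type u} [NontriviallyNormedField k] (c : BanachConvention k) where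
  carrier : Type u
  [normedAddCommGroup : NormedAddCommGroup carrier]
  [normedSpace : NormedSpace k carrier]
  [completeSpace : CompleteSpace carrier]
  admissible : c.Admissible carrier

attribute [instance] Ban.normedAddCommGroup Ban.normedSpace Ban.completeSpace

namespace Ban

variable {k : Type u} [NontriviallyNormedField k] {c : BanachConvention k}

instance : CoeSort (Ban c) (Type u) := ⟨Ban.carrier⟩

/-- Morphisms of `Ban_k`: bounded linear maps. -/
@[ext]
structure Hom (V W : Ban c) where
  clm : V →L[k] W

instance : Category.{u} (Ban c) where
  Hom V W := Hom V W
  id V := ⟨ContinuousLinearMap.id k V⟩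
  comp f g := ⟨g.clm.comp f.clm⟩

theorem hom_ext {V W : Ban c} {f g : V ⟶ W} (h : ∀ v, Hom.clm f v = Hom.clm g v) : f = g :=
  Hom.ext (ContinuousLinearMap.ext h)

@[simp] theorem id_clm (V : Ban c) : Hom.clm (𝟙 V) = ContinuousLinearMap.id k V := rfl

@[simp] theorem comp_clm {U V W : Ban c} (f : U ⟶ V) (g : V ⟶ W) :
    Hom.clm (f ≫ g) = (Hom.clm g).comp (Hom.clm f) := rfl

/-- The completed projective tensor product `V ⊗̂ W`. -/
noncomputable def tens (V W : Ban c) : Ban c where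
  carrier := UniformSpace.Completion (PreTensor c V W)
  admissible := fun x y => by
    refine UniformSpace.Completion.induction_on₂ x y (isClosed_le
      continuous_add.norm (c.continuous_op.comp
        (continuous_fst.norm.prodMk continuous_snd.norm))) fun s t => ?_
    rw [← UniformSpace.Completion.coe_add]
    simp only [UniformSpace.Completion.norm_coe]
    exact PreTensor.projNorm_add c s t

/-- The canonical bounded bilinear map `(v, w) ↦ v ⊗ w`. -/
noncomputable def pure (V W : Ban c) : V →L[k] W →L[k] tens V W :=
  LinearMap.mkContinuous₂
    ((PreTensor.tmul c V W).compr₂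
      (UniformSpace.Completion.toComplL (𝕜 := k) (E := PreTensor c V W)).toLinearMap) 1 (fun v w => by
        rw [one_mul]
        exact (UniformSpace.Completion.norm_coe _).trans_le (PreTensor.norm_tmul_le c v w))

/-- The bounded linear map out of `V ⊗̂ W` induced by a bounded bilinear map. -/
noncomputable def liftFun {V W Z : Ban c} (f : V →L[k] W →L[k] Z) : tens V W →L[k] Z :=
  (PreTensor.liftAux c Z.admissible f).extend
    (UniformSpace.Completion.toComplL (𝕜 := k) (E := PreTensor c V W))

theorem liftFun_pure {V W Z : Ban c} (f : V →L[k] W →L[k] Z) (v : V) (w : W) :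
    liftFun f (pure V W v w) = f v w :=
  (ContinuousLinearMap.extend_eq _ UniformSpace.Completion.denseRange_coe
    (UniformSpace.Completion.isUniformInducing_coe _) _).trans
    (PreTensor.liftAux_tmul c Z.admissible f v w)

/-- Bounded linear maps on `V ⊗̂ W` are determined by elementary tensors. -/
theorem clm_ext {V W Z : Ban c} {f g : tens V W →L[k] Z}
    (h : ∀ v w, f (pure V W v w) = g (pure V W v w)) : f = g := by
  have e : f.comp (UniformSpace.Completion.toComplL (𝕜 := k) (E := PreTensor c V W)) =
      g.comp (UniformSpace.Completion.toComplL (𝕜 := k) (E := PreTensor c V W)) :=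
    PreTensor.clm_ext c h
  refine ContinuousLinearMap.ext fun t => ?_
  refine UniformSpace.Completion.induction_on t (isClosed_eq f.continuous g.continuous) fun s => ?_
  exact DFunLike.congr_fun e s

theorem norm_liftFun_le {V W Z : Ban c} (f : V →L[k] W →L[k] Z) : ‖liftFun f‖ ≤ ‖f‖ := by
  refine ContinuousLinearMap.opNorm_le_bound _ (norm_nonneg f) fun t => ?_
  refine UniformSpace.Completion.induction_on t (isClosed_le (liftFun f).continuous.norm
    (continuous_const.mul continuous_norm)) fun s => ?_
  have e : liftFun f (s : UniformSpace.Completion (PreTensor c V W)) =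
      PreTensor.liftAux c Z.admissible f s :=
    ContinuousLinearMap.extend_eq _ UniformSpace.Completion.denseRange_coe
      (UniformSpace.Completion.isUniformInducing_coe _) _
  rw [e]
  exact (ContinuousLinearMap.le_of_opNorm_le _
    (PreTensor.norm_liftAux_le c Z.admissible f) s).trans_eq
    (congrArg (‖f‖ * ·) (UniformSpace.Completion.norm_coe s).symm)

/-- `liftFun` as a bounded linear map. -/
noncomputable def lift (V W Z : Ban c) : (V →L[k] W →L[k] Z) →L[k] tens V W →L[k] Z :=
  LinearMap.mkContinuous
    { toFun := fun f => liftFun (V := V) (W := W) (Z := Z) f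
      map_add' := fun f g => clm_ext (V := V) (W := W) (Z := Z) fun v w => by
        rw [liftFun_pure]
        exact (congrArg₂ (· + ·) (liftFun_pure f v w) (liftFun_pure g v w)).symm
      map_smul' := fun a f => clm_ext (V := V) (W := W) (Z := Z) fun v w => by
        rw [liftFun_pure]
        exact (congrArg (a • ·) (liftFun_pure f v w)).symm } 1
    (fun f => by rw [one_mul]; exact norm_liftFun_le f)

@[simp] theorem lift_pure {V W Z : Ban c} (f : V →L[k] W →L[k] Z) (v : V) (w : W) :
    lift V W Z f (pure V W v w) = f v w := liftFun_pure f v w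

theorem tens_ext {V W Z : Ban c} {f g : tens V W ⟶ Z}
    (h : ∀ v w, Hom.clm f (pure V W v w) = Hom.clm g (pure V W v w)) : f = g :=
  Hom.ext (clm_ext h)

theorem tens_ext₃ {U V W Z : Ban c} {f g : tens (tens U V) W ⟶ Z}
    (h : ∀ u v w, Hom.clm f (pure _ W (pure U V u v) w) = Hom.clm g (pure _ W (pure U V u v) w)) :
    f = g := by
  refine tens_ext fun t w => ?_
  have e : ((Hom.clm f).comp ((pure (tens U V) W).flip w)) =
      ((Hom.clm g).comp ((pure (tens U V) W).flip w)) := clm_ext fun u v => h u v w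
  exact DFunLike.congr_fun e t

theorem tens_ext₃' {U V W Z : Ban c} {f g : tens U (tens V W) ⟶ Z}
    (h : ∀ u v w, Hom.clm f (pure U _ u (pure V W v w)) = Hom.clm g (pure U _ u (pure V W v w))) :
    f = g := by
  refine tens_ext fun u t => ?_
  have e : ((Hom.clm f).comp (pure U (tens V W) u)) =
      ((Hom.clm g).comp (pure U (tens V W) u)) := clm_ext fun v w => h u v w
  exact DFunLike.congr_fun e t

theorem tens_ext₄ {T U V W Z : Ban c} {f g : tens (tens (tens T U) V) W ⟶ Z}
    (h : ∀ t u v w, Hom.clm f (pure _ W (pure _ V (pure T U t u) v) w) =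
      Hom.clm g (pure _ W (pure _ V (pure T U t u) v) w)) : f = g := by
  refine tens_ext₃ fun s v w => ?_
  have e : ((Hom.clm f).comp (((pure (tens (tens T U) V) W).flip w).comp
      ((pure (tens T U) V).flip v))) = ((Hom.clm g).comp (((pure (tens (tens T U) V) W).flip w).comp
      ((pure (tens T U) V).flip v))) := clm_ext fun t u => h t u v w
  exact DFunLike.congr_fun e s

/-- The Banach space of bounded linear maps with the operator norm. -/
noncomputable def hom (V W : Ban c) : Ban c where
  carrier := V →L[k] W
  admissible := fun f g => by
    refine ContinuousLinearMap.opNorm_le_bound _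
      (c.op_nonneg (norm_nonneg f) (norm_nonneg g)) fun x => ?_
    rw [add_apply, mul_comm, c.mul_op (norm_nonneg x)]
    refine (W.admissible _ _).trans (c.op_mono ?_ ?_)
    · rw [mul_comm]
      exact f.le_opNorm x
    · rw [mul_comm]
      exact g.le_opNorm x

/-- `f ⊗̂ g`. -/
noncomputable def tensMap {V W V' W' : Ban c} (f : V ⟶ V') (g : W ⟶ W') :
    tens V W ⟶ tens V' W' :=
  ⟨lift V W (tens V' W') ((pure V' W').bilinearComp (Hom.clm f) (Hom.clm g))⟩

@[simp] theorem tensMap_pure {V W V' W' : Ban c} (f : V ⟶ V') (g : W ⟶ W') (v : V) (w : W) :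
    Hom.clm (tensMap f g) (pure V W v w) = pure V' W' (Hom.clm f v) (Hom.clm g w) :=
  lift_pure _ v w

/-- The trilinear map `(u, v, w) ↦ u ⊗ (v ⊗ w)`. -/
noncomputable def pureRight (U V W : Ban c) : U →L[k] V →L[k] W →L[k] tens U (tens V W) :=
  ((ContinuousLinearMap.compL k V (W →L[k] tens V W) (W →L[k] tens U (tens V W))).flip
    (pure V W)).comp ((ContinuousLinearMap.compL k W (tens V W) (tens U (tens V W))).comp
      (pure U (tens V W)))

@[simp] theorem pureRight_apply (U V W : Ban c) (u : U) (v : V) (w : W) :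
    pureRight U V W u v w = pure U (tens V W) u (pure V W v w) := rfl

/-- The trilinear map `(u, v, w) ↦ (u ⊗ v) ⊗ w`. -/
noncomputable def pureLeft (U V W : Ban c) : U →L[k] V →L[k] W →L[k] tens (tens U V) W :=
  (ContinuousLinearMap.compL k V (tens U V) (W →L[k] tens (tens U V) W)
    (pure (tens U V) W)).comp (pure U V)

@[simp] theorem pureLeft_apply (U V W : Ban c) (u : U) (v : V) (w : W) :
    pureLeft U V W u v w = pure (tens U V) W (pure U V u v) w := rfl

/-- The associator, `(u ⊗ v) ⊗ w ↦ u ⊗ (v ⊗ w)`. -/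
noncomputable def assocHom (U V W : Ban c) : tens (tens U V) W ⟶ tens U (tens V W) :=
  ⟨lift (tens U V) W (tens U (tens V W)) (lift U V (hom W (tens U (tens V W))) (pureRight U V W))⟩

theorem assocHom_pure (U V W : Ban c) (u : U) (v : V) (w : W) :
    Hom.clm (assocHom U V W) (pure _ W (pure U V u v) w) = pure U _ u (pure V W v w) :=
  (lift_pure _ _ w).trans (DFunLike.congr_fun (F := W →L[k] tens U (tens V W))
    (lift_pure (Z := hom W (tens U (tens V W))) (pureRight U V W) u v) w)

/-- The inverse associator, `u ⊗ (v ⊗ w) ↦ (u ⊗ v) ⊗ w`. -/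
noncomputable def assocInv (U V W : Ban c) : tens U (tens V W) ⟶ tens (tens U V) W :=
  ⟨lift U (tens V W) (tens (tens U V) W)
    ((lift V W (tens (tens U V) W)).comp (pureLeft U V W))⟩

theorem assocInv_pure (U V W : Ban c) (u : U) (v : V) (w : W) :
    Hom.clm (assocInv U V W) (pure U _ u (pure V W v w)) = pure _ W (pure U V u v) w :=
  (lift_pure _ u _).trans (lift_pure (pureLeft U V W u) v w)

section Unit

variable [CompleteSpace k]

/-- The ground field. -/
noncomputable def unit (c : BanachConvention k) : Ban c where
  carrier := k
  admissible := c.admissible_field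

/-- The left unitor `a ⊗ v ↦ a v`. -/
noncomputable def leftHom (V : Ban c) : tens (unit c) V ⟶ V :=
  ⟨lift (unit c) V V (ContinuousLinearMap.lsmul k k)⟩

theorem leftHom_pure (V : Ban c) (a : k) (v : V) :
    Hom.clm (leftHom V) (pure (unit c) V a v) = a • v :=
  lift_pure (V := unit c) (W := V) (Z := V) (ContinuousLinearMap.lsmul k k) a v

/-- The right unitor `v ⊗ a ↦ a v`. -/
noncomputable def rightHom (V : Ban c) : tens V (unit c) ⟶ V :=
  ⟨lift V (unit c) V (ContinuousLinearMap.lsmul k k).flip⟩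

theorem rightHom_pure (V : Ban c) (v : V) (a : k) :
    Hom.clm (rightHom V) (pure V (unit c) v a) = a • v :=
  lift_pure (V := V) (W := unit c) (Z := V) (ContinuousLinearMap.lsmul k k).flip v a

/-- `v ↦ 1 ⊗ v`. -/
noncomputable def leftInv (V : Ban c) : V ⟶ tens (unit c) V := ⟨pure (unit c) V (1 : k)⟩

/-- `v ↦ v ⊗ 1`. -/
noncomputable def rightInv (V : Ban c) : V ⟶ tens V (unit c) := ⟨(pure V (unit c)).flip (1 : k)⟩

theorem pure_unit_left (V : Ban c) (a : k) (v : V) :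
    pure (unit c) V a v = a • pure (unit c) V (1 : k) v := by
  have h := map_smul (pure (unit c) V) a (show unit c from (1 : k))
  have e : a • (show unit c from (1 : k)) = a := mul_one (a : k)
  rw [e] at h
  exact DFunLike.congr_fun h v

theorem pure_unit_right (V : Ban c) (v : V) (a : k) :
    pure V (unit c) v a = a • pure V (unit c) v (1 : k) := by
  have h := map_smul (pure V (unit c) v) a (show unit c from (1 : k))
  have e : a • (show unit c from (1 : k)) = a := mul_one (a : k)
  rw [e] at h
  exact h

end Unit

/-- The symmetry `v ⊗ w ↦ w ⊗ v`. -/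
noncomputable def swap (V W : Ban c) : tens V W ⟶ tens W V :=
  ⟨lift V W (tens W V) (pure W V).flip⟩

theorem swap_pure (V W : Ban c) (v : V) (w : W) :
    Hom.clm (swap V W) (pure V W v w) = pure W V w v :=
  lift_pure (V := V) (W := W) (Z := tens W V) (pure W V).flip v w

end Ban

namespace Ban

variable {k : Type u} [NontriviallyNormedField k] [CompleteSpace k] {c : BanachConvention k}

noncomputable instance : MonoidalCategoryStruct (Ban c) where
  tensorObj := tens
  whiskerLeft V _ _ f := tensMap (𝟙 V) f
  whiskerRight f W := tensMap f (𝟙 W)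
  tensorHom := tensMap
  tensorUnit := unit c
  associator U V W :=
    { hom := assocHom U V W
      inv := assocInv U V W
      hom_inv_id := tens_ext₃ fun u v w =>
        (congrArg (Hom.clm (assocInv U V W)) (assocHom_pure U V W u v w)).trans
          (assocInv_pure U V W u v w)
      inv_hom_id := tens_ext₃' fun u v w =>
        (congrArg (Hom.clm (assocHom U V W)) (assocInv_pure U V W u v w)).trans
          (assocHom_pure U V W u v w) }
  leftUnitor V :=
    { hom := leftHom V
      inv := leftInv V
      hom_inv_id := tens_ext fun (a : k) v =>
        (congrArg (Hom.clm (leftInv V)) (leftHom_pure V a v)).trans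
          ((map_smul (pure (unit c) V (1 : k)) a v).trans (pure_unit_left V a v).symm)
      inv_hom_id := hom_ext fun v => (leftHom_pure V 1 v).trans (one_smul k v) }
  rightUnitor V :=
    { hom := rightHom V
      inv := rightInv V
      hom_inv_id := tens_ext fun v (a : k) =>
        (congrArg (Hom.clm (rightInv V)) (rightHom_pure V v a)).trans
          ((map_smul ((pure V (unit c)).flip (1 : k)) a v).trans (pure_unit_right V v a).symm)
      inv_hom_id := hom_ext fun v => (rightHom_pure V v 1).trans (one_smul k v) }

/-- The monoidal structure on `Ban_k` given by the completed projective tensor product. -/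
noncomputable instance : MonoidalCategory (Ban c) :=
  MonoidalCategory.ofTensorHom
    (id_tensorHom_id := fun V W => tens_ext fun v w => tensMap_pure (𝟙 V) (𝟙 W) v w)
    (id_tensorHom := fun _ _ _ _ => rfl)
    (tensorHom_id := fun _ _ => rfl)
    (tensorHom_comp_tensorHom := fun f₁ f₂ g₁ g₂ => tens_ext fun v w =>
      (congrArg (Hom.clm (tensMap g₁ g₂)) (tensMap_pure f₁ f₂ v w)).trans
        ((tensMap_pure g₁ g₂ _ _).trans (tensMap_pure (f₁ ≫ g₁) (f₂ ≫ g₂) v w).symm))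
    (associator_naturality := fun {U V W U' V' W'} f g h => tens_ext₃ fun u v w =>
      (congrArg (Hom.clm (assocHom U' V' W')) ((tensMap_pure (tensMap f g) h _ w).trans
        (congrArg (fun t => pure (tens U' V') W' t (Hom.clm h w)) (tensMap_pure f g u v)))).trans
      ((assocHom_pure U' V' W' _ _ _).trans
        ((congrArg (Hom.clm (tensMap f (tensMap g h))) (assocHom_pure U V W u v w)).trans
          ((tensMap_pure f (tensMap g h) u _).trans
            (congrArg (pure U' (tens V' W') (Hom.clm f u)) (tensMap_pure g h v w)))).symm))
    (leftUnitor_naturality := fun {V W} f => tens_ext fun (a : k) v =>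
      (congrArg (Hom.clm (leftHom W)) (tensMap_pure (𝟙 (unit c)) f a v)).trans
        ((leftHom_pure W a _).trans
          ((congrArg (Hom.clm f) (leftHom_pure V a v)).trans (map_smul (Hom.clm f) a v)).symm))
    (rightUnitor_naturality := fun {V W} f => tens_ext fun v (a : k) =>
      (congrArg (Hom.clm (rightHom W)) (tensMap_pure f (𝟙 (unit c)) v a)).trans
        ((rightHom_pure W _ a).trans
          ((congrArg (Hom.clm f) (rightHom_pure V v a)).trans (map_smul (Hom.clm f) a v)).symm))
    (pentagon := fun W X Y Z => tens_ext₄ fun a b d e => by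
      change Hom.clm (tensMap (𝟙 W) (assocHom X Y Z)) (Hom.clm (assocHom W (tens X Y) Z)
          (Hom.clm (tensMap (assocHom W X Y) (𝟙 Z)) (pure _ Z (pure _ Y (pure W X a b) d) e))) =
        Hom.clm (assocHom W X (tens Y Z)) (Hom.clm (assocHom (tens W X) Y Z)
          (pure _ Z (pure _ Y (pure W X a b) d) e))
      rw [tensMap_pure, assocHom_pure, assocHom_pure, assocHom_pure, assocHom_pure, tensMap_pure]
      exact congrArg (pure W (tens X (tens Y Z)) a) (assocHom_pure X Y Z b d e))
    (triangle := fun V W => tens_ext₃ fun v (a : k) w =>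
      (congrArg (Hom.clm (tensMap (𝟙 V) (leftHom W))) (assocHom_pure V (unit c) W v a w)).trans
        ((tensMap_pure (𝟙 V) (leftHom W) v _).trans
          ((congrArg (pure V W v) (leftHom_pure W a w)).trans
            (((map_smul (pure V W v) a w).trans
              (DFunLike.congr_fun (map_smul (pure V W) a v) w).symm).trans
              ((tensMap_pure (rightHom V) (𝟙 W) _ w).trans
                (congrArg (fun t => pure V W t w) (rightHom_pure V v a))).symm))))

noncomputable instance : SymmetricCategory (Ban c) where
  braiding V W :=
    { hom := swap V W
      inv := swap W V
      hom_inv_id := tens_ext fun v w =>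
        (congrArg (Hom.clm (swap W V)) (swap_pure V W v w)).trans (swap_pure W V w v)
      inv_hom_id := tens_ext fun v w =>
        (congrArg (Hom.clm (swap V W)) (swap_pure W V v w)).trans (swap_pure V W w v) }
  braiding_naturality_right X Y Z f := tens_ext fun v w =>
    (congrArg (Hom.clm (swap X Z)) (tensMap_pure (𝟙 X) f v w)).trans ((swap_pure X Z _ _).trans
      ((congrArg (Hom.clm (tensMap f (𝟙 X))) (swap_pure X Y v w)).trans
        (tensMap_pure f (𝟙 X) w v)).symm)
  braiding_naturality_left {X Y} f Z := tens_ext fun v w =>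
    (congrArg (Hom.clm (swap Y Z)) (tensMap_pure f (𝟙 Z) v w)).trans ((swap_pure Y Z _ _).trans
      ((congrArg (Hom.clm (tensMap (𝟙 Z) f)) (swap_pure X Z v w)).trans
        (tensMap_pure (𝟙 Z) f w v)).symm)
  hexagon_forward X Y Z := tens_ext₃ fun x y z => by
    change Hom.clm (assocHom Y Z X) (Hom.clm (swap X (tens Y Z)) (Hom.clm (assocHom X Y Z)
        (pure _ Z (pure X Y x y) z))) =
      Hom.clm (tensMap (𝟙 Y) (swap X Z)) (Hom.clm (assocHom Y X Z)
        (Hom.clm (tensMap (swap X Y) (𝟙 Z)) (pure _ Z (pure X Y x y) z)))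
    rw [assocHom_pure, swap_pure, assocHom_pure, tensMap_pure, swap_pure, assocHom_pure,
      tensMap_pure, id_clm, id_clm]
    exact congrArg (pure Y (tens Z X) y) (swap_pure X Z x z).symm
  hexagon_reverse X Y Z := tens_ext₃' fun x y z => by
    change Hom.clm (assocInv Z X Y) (Hom.clm (swap (tens X Y) Z) (Hom.clm (assocInv X Y Z)
        (pure X _ x (pure Y Z y z)))) =
      Hom.clm (tensMap (swap X Z) (𝟙 Y)) (Hom.clm (assocInv X Z Y)
        (Hom.clm (tensMap (𝟙 X) (swap Y Z)) (pure X _ x (pure Y Z y z))))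
    rw [assocInv_pure, swap_pure, assocInv_pure, tensMap_pure, swap_pure, assocInv_pure,
      tensMap_pure, id_clm, id_clm]
    exact congrArg (fun t => pure (tens Z X) Y t y) (swap_pure X Z x z).symm
  symmetry V W := tens_ext fun v w =>
    (congrArg (Hom.clm (swap W V)) (swap_pure V W v w)).trans (swap_pure W V w v)

/-- The internal hom functor `[V, -]`. -/
noncomputable def homFunctor (V : Ban c) : Ban c ⥤ Ban c where
  obj W := hom V W
  map {W W'} f := ⟨ContinuousLinearMap.compL k V W W' (Hom.clm f)⟩

/-- The closed structure: maps `V ⊗̂ Z ⟶ Y` correspond to maps `Z ⟶ [V, Y]`. -/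
noncomputable instance : MonoidalClosed (Ban c) where
  closed V :=
    { rightAdj := homFunctor V
      adj := Adjunction.mkOfHomEquiv
        { homEquiv := fun Z Y =>
            { toFun := fun f => (⟨((ContinuousLinearMap.compL k Z (tens V Z) Y (Hom.clm f)).comp
                (pure V Z)).flip⟩ : Z ⟶ hom V Y)
              invFun := fun g => (⟨lift V Z Y
                (ContinuousLinearMap.flip (show Z →L[k] V →L[k] Y from Hom.clm g))⟩ :
                tens V Z ⟶ Y)
              left_inv := fun f => tens_ext fun v z => lift_pure _ v z
              right_inv := fun g => hom_ext fun z => ContinuousLinearMap.ext fun v =>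
                lift_pure (V := V) (W := Z) (Z := Y) _ v z }
          homEquiv_naturality_left_symm := fun {Z' Z Y} f g => tens_ext fun v z =>
            (lift_pure (V := V) (W := Z') (Z := Y) _ v z).trans
              ((congrArg (Hom.clm (⟨lift V Z Y (ContinuousLinearMap.flip
                (show Z →L[k] V →L[k] Y from Hom.clm g))⟩ : tens V Z ⟶ Y))
                (tensMap_pure (𝟙 V) f v z)).trans (lift_pure (V := V) (W := Z) (Z := Y) _ _ _)).symm
          homEquiv_naturality_right := fun _ _ => rfl } }

end Ban

namespace IndDiagram

theorem Germ.exists_common {C : Type u} [Category.{v} C] {c d : C} {Y : IndDiagram.{v} C}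
    (x : Germ c Y) (y : Germ d Y) :
    ∃ (j : Y.Idx) (f : c ⟶ Y.diag.obj j) (g : d ⟶ Y.diag.obj j),
      Germ.mk j f = x ∧ Germ.mk j g = y := by
  obtain ⟨i, f, rfl⟩ := x.exists_rep
  obtain ⟨j, g, rfl⟩ := y.exists_rep
  exact ⟨IsFiltered.max i j, f ≫ Y.diag.map (IsFiltered.leftToMax i j),
    g ≫ Y.diag.map (IsFiltered.rightToMax i j), Germ.mk_map _ _, Germ.mk_map _ _⟩

section BanLimits

variable {k : Type u} [NontriviallyNormedField k] {c : BanachConvention k}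
variable {J : Type u} [SmallCategory J] (D : J ⥤ IndDiagram.{u} (Ban c))

/-- The index of one Banach space in the ind-object `lim D`: a stage `s j` of each `D j`, a scalar
for each `j` (fixing a weight for a supremum norm), and for each `u : j ⟶ j'` a stage of `D j'`
at which a representative of `D u` can be compared with `s j'`. -/
structure LimIdx where
  s : ∀ j, (D.obj j).Idx
  scal : J → kˣ
  n : ∀ {j j' : J}, (j ⟶ j') → (D.obj j').Idx
  φ : ∀ {j j' : J} (a : j ⟶ j'), (D.obj j).diag.obj (s j) ⟶ (D.obj j').diag.obj (n a)
  hφ : ∀ {j j' : J} (a : j ⟶ j'), Hom.app (D.map a) (s j) = Germ.mk (n a) (φ a)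
  q : ∀ {j j' : J} (a : j ⟶ j'), s j' ⟶ n a

namespace LimIdx

variable {D} (κ : LimIdx D)

/-- The condition that `((scal j)⁻¹ x j)` is a compatible family. -/
def submodule : Submodule k (lp (fun j => ((D.obj j).diag.obj (κ.s j) : Type u)) ⊤) where
  carrier := {x | ∀ {j j' : J} (a : j ⟶ j'), (Ban.Hom.clm (κ.φ a)) ((κ.scal j)⁻¹ • x j) =
    (Ban.Hom.clm ((D.obj j').diag.map (κ.q a))) ((κ.scal j')⁻¹ • x j')}
  add_mem' := fun {x y} hx hy j j' a => by
    rw [lp.coeFn_add, Pi.add_apply, Pi.add_apply, smul_add, smul_add, map_add, map_add, hx a, hy a]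
  zero_mem' := fun {j j'} a => by
    rw [lp.coeFn_zero, Pi.zero_apply, Pi.zero_apply, smul_zero, smul_zero, map_zero, map_zero]
  smul_mem' := fun r {x} hx j j' a => by
    rw [lp.coeFn_smul, Pi.smul_apply, Pi.smul_apply, smul_comm, smul_comm _ r (x j')]
    exact (map_smul (Ban.Hom.clm (κ.φ a)) r _).trans ((congrArg (r • ·) (hx a)).trans
      (map_smul (Ban.Hom.clm ((D.obj j').diag.map (κ.q a))) r _).symm)

/-- Evaluation at `j` as a bounded linear map. -/
noncomputable def eval (j : J) :
    lp (fun j => ((D.obj j).diag.obj (κ.s j) : Type u)) ⊤ →L[k] (D.obj j).diag.obj (κ.s j) :=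
  LinearMap.mkContinuous
    { toFun := fun x => x j
      map_add' := fun _ _ => rfl
      map_smul' := fun _ _ => rfl } 1
    (fun x => by rw [one_mul]; exact lp.norm_apply_le_norm (by simp) x j)

theorem isClosed_submodule :
    IsClosed (κ.submodule : Set (lp (fun j => ((D.obj j).diag.obj (κ.s j) : Type u)) ⊤)) := by
  have h : (κ.submodule : Set (lp (fun j => ((D.obj j).diag.obj (κ.s j) : Type u)) ⊤)) =
      ⋂ (j : J) (j' : J) (a : j ⟶ j'), {x | (Ban.Hom.clm (κ.φ a)) ((κ.scal j)⁻¹ • κ.eval j x) =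
        (Ban.Hom.clm ((D.obj j').diag.map (κ.q a))) ((κ.scal j')⁻¹ • κ.eval j' x)} := by
    ext x
    simp only [Set.mem_iInter]
    rfl
  rw [h]
  refine isClosed_iInter fun j => isClosed_iInter fun j' => isClosed_iInter fun a =>
    isClosed_eq ?_ ?_
  · exact (Ban.Hom.clm _).continuous.comp ((κ.eval j).continuous.const_smul _)
  · exact (Ban.Hom.clm _).continuous.comp ((κ.eval j').continuous.const_smul _)

/-- The Banach space of compatible families, with a weighted supremum norm. -/
noncomputable def space : Ban c where
  carrier := κ.submodule
  completeSpace := κ.isClosed_submodule.completeSpace_coe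
  admissible := fun x y => by
    refine lp.norm_le_of_forall_le (c.op_nonneg (norm_nonneg x) (norm_nonneg y)) fun j => ?_
    refine (((D.obj j).diag.obj (κ.s j)).admissible _ _).trans (c.op_mono ?_ ?_)
    · exact lp.norm_apply_le_norm (by simp) x.1 j
    · exact lp.norm_apply_le_norm (by simp) y.1 j

/-- The projection to `D j` at stage `s j`. -/
noncomputable def proj (j : J) : κ.space ⟶ (D.obj j).diag.obj (κ.s j) :=
  ⟨((κ.scal j)⁻¹ : kˣ) • (κ.eval j).comp κ.submodule.subtypeL⟩

theorem proj_comp {j j' : J} (a : j ⟶ j') :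
    κ.proj j ≫ κ.φ a = κ.proj j' ≫ (D.obj j').diag.map (κ.q a) :=
  Ban.hom_ext fun x => x.2 a

/-- The germ of the projection to `D j`. -/
noncomputable def elt (j : J) : Germ κ.space (D.obj j) := Germ.mk (κ.s j) (κ.proj j)

theorem post_elt {j j' : J} (a : j ⟶ j') : Germ.post (D.map a) (κ.elt j) = κ.elt j' := by
  rw [elt, Germ.post_mk, κ.hφ a, Germ.pre_mk, κ.proj_comp a, Germ.mk_map]
  rfl

/-- The map to `κ.space` induced by a compatible family of maps. -/
noncomputable def lift {V : Ban c} (f : ∀ j, V ⟶ (D.obj j).diag.obj (κ.s j))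
    (h : ∀ {j j' : J} (a : j ⟶ j'), f j ≫ κ.φ a = f j' ≫ (D.obj j').diag.map (κ.q a))
    (hb : ∀ j v, ‖κ.scal j • Ban.Hom.clm (f j) v‖ ≤ ‖v‖) : V ⟶ κ.space :=
  ⟨LinearMap.mkContinuous (F := κ.submodule)
    { toFun := fun v => ⟨⟨fun j => κ.scal j • Ban.Hom.clm (f j) v,
          memℓp_infty ⟨‖v‖, by rintro _ ⟨j, rfl⟩; exact hb j v⟩⟩, fun {j j'} a => by
        exact (congrArg (Ban.Hom.clm (κ.φ a)) (inv_smul_smul (κ.scal j) _)).trans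
          ((DFunLike.congr_fun (congrArg Ban.Hom.clm (h a)) v).trans
            (congrArg (Ban.Hom.clm ((D.obj j').diag.map (κ.q a)))
              (inv_smul_smul (κ.scal j') _)).symm)⟩
      map_add' := fun v w => Subtype.ext (lp.ext (funext fun j => by
        change κ.scal j • Ban.Hom.clm (f j) (v + w) =
          κ.scal j • Ban.Hom.clm (f j) v + κ.scal j • Ban.Hom.clm (f j) w
        rw [map_add, smul_add]))
      map_smul' := fun r v => Subtype.ext (lp.ext (funext fun j => by
        change κ.scal j • Ban.Hom.clm (f j) (r • v) = r • κ.scal j • Ban.Hom.clm (f j) v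
        rw [map_smul, smul_comm])) } 1
    (fun v => by
      rw [one_mul]
      exact lp.norm_le_of_forall_le (norm_nonneg v) fun j => hb j v)⟩

theorem lift_proj {V : Ban c} (f : ∀ j, V ⟶ (D.obj j).diag.obj (κ.s j)) (h) (hb) (j : J) :
    κ.lift f h hb ≫ κ.proj j = f j :=
  Ban.hom_ext fun v => inv_smul_smul (κ.scal j) (Ban.Hom.clm (f j) v)

theorem space_ext {V : Ban c} {f g : V ⟶ κ.space} (h : ∀ j, f ≫ κ.proj j = g ≫ κ.proj j) :
    f = g := by
  refine Ban.hom_ext fun v => Subtype.ext (lp.ext (funext fun j => ?_))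
  have e := DFunLike.congr_fun (congrArg Ban.Hom.clm (h j)) v
  exact (smul_left_cancel_iff (κ.scal j)⁻¹).1 e

end LimIdx

/-- Two compatible families of germs factor jointly through one of the spaces `κ.space`. -/
theorem exists_limIdx {V₁ V₂ : Ban c} (s : ∀ j, (D.obj j).Idx)
    (f₁ : ∀ j, V₁ ⟶ (D.obj j).diag.obj (s j)) (f₂ : ∀ j, V₂ ⟶ (D.obj j).diag.obj (s j))
    (h₁ : ∀ {j j' : J} (a : j ⟶ j'), Germ.post (D.map a) (Germ.mk (s j) (f₁ j)) =
      Germ.mk (s j') (f₁ j'))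
    (h₂ : ∀ {j j' : J} (a : j ⟶ j'), Germ.post (D.map a) (Germ.mk (s j) (f₂ j)) =
      Germ.mk (s j') (f₂ j')) :
    ∃ (κ : LimIdx D) (S₁ : V₁ ⟶ κ.space) (S₂ : V₂ ⟶ κ.space),
      (∀ j, (κ.elt j).pre S₁ = Germ.mk (s j) (f₁ j)) ∧
      (∀ j, (κ.elt j).pre S₂ = Germ.mk (s j) (f₂ j)) ∧
      ∀ (W : Ban c) (T₁ : W ⟶ V₁) (T₂ : W ⟶ V₂), (∀ j, T₁ ≫ f₁ j = T₂ ≫ f₂ j) →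
        T₁ ≫ S₁ = T₂ ≫ S₂ := by
  have hn : ∀ (j j' : J) (a : j ⟶ j'), ∃ (n : (D.obj j').Idx)
      (φ : (D.obj j).diag.obj (s j) ⟶ (D.obj j').diag.obj n) (q : s j' ⟶ n),
      Hom.app (D.map a) (s j) = Germ.mk n φ ∧
      f₁ j ≫ φ = f₁ j' ≫ (D.obj j').diag.map q ∧ f₂ j ≫ φ = f₂ j' ≫ (D.obj j').diag.map q := by
    intro j j' a
    obtain ⟨m, ψ, hψ⟩ := (Hom.app (D.map a) (s j)).exists_rep
    have e₁ := h₁ a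
    have e₂ := h₂ a
    rw [Germ.post_mk, hψ, Germ.pre_mk, Germ.mk_eq_mk_iff] at e₁ e₂
    obtain ⟨l, p, r, e₁⟩ := e₁
    obtain ⟨l', p', r', e₂⟩ := e₂
    obtain ⟨n, α, β, hα, hβ⟩ := IsFiltered.bowtie p p' r r'
    refine ⟨n, ψ ≫ (D.obj j').diag.map (p ≫ α), r ≫ α, ?_, ?_, ?_⟩
    · rw [hψ, Germ.mk_map]
    · rw [Functor.map_comp, Functor.map_comp, ← Category.assoc, ← Category.assoc, ← Category.assoc,
        e₁]
    · rw [hα, hβ, Functor.map_comp, Functor.map_comp, ← Category.assoc, ← Category.assoc,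
        ← Category.assoc, e₂]
  choose n φ q hφ hq₁ hq₂ using hn
  have hl : ∀ j, ∃ r : kˣ, ‖(r : k)‖ * (‖Ban.Hom.clm (f₁ j)‖ + ‖Ban.Hom.clm (f₂ j)‖) ≤ 1 := by
    intro j
    obtain ⟨x, hx, hx'⟩ := NormedField.exists_norm_lt k
      (show 0 < (‖Ban.Hom.clm (f₁ j)‖ + ‖Ban.Hom.clm (f₂ j)‖ + 1)⁻¹ by positivity)
    refine ⟨Units.mk0 x (norm_pos_iff.1 hx), ?_⟩
    have hpos : 0 < ‖Ban.Hom.clm (f₁ j)‖ + ‖Ban.Hom.clm (f₂ j)‖ + 1 := by positivity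
    have h := mul_le_mul_of_nonneg_right hx'.le hpos.le
    rw [inv_mul_cancel₀ hpos.ne'] at h
    change ‖x‖ * _ ≤ 1
    nlinarith
  choose r hr using hl
  have hb₁ : ∀ j v, ‖r j • Ban.Hom.clm (f₁ j) v‖ ≤ ‖v‖ := fun j v => by
    rw [Units.smul_def, norm_smul]
    have h1 := (Ban.Hom.clm (f₁ j)).le_opNorm v
    have h2 := hr j
    have h3 : 0 ≤ ‖(r j : k)‖ * ‖Ban.Hom.clm (f₂ j)‖ := by positivity
    have h4 := mul_le_mul_of_nonneg_left h1 (norm_nonneg (r j : k))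
    have h5 := mul_le_mul_of_nonneg_right
      (show ‖(r j : k)‖ * ‖Ban.Hom.clm (f₁ j)‖ ≤ 1 by linarith) (norm_nonneg v)
    linarith
  have hb₂ : ∀ j v, ‖r j • Ban.Hom.clm (f₂ j) v‖ ≤ ‖v‖ := fun j v => by
    rw [Units.smul_def, norm_smul]
    have h1 := (Ban.Hom.clm (f₂ j)).le_opNorm v
    have h2 := hr j
    have h3 : 0 ≤ ‖(r j : k)‖ * ‖Ban.Hom.clm (f₁ j)‖ := by positivity
    have h4 := mul_le_mul_of_nonneg_left h1 (norm_nonneg (r j : k))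
    have h5 := mul_le_mul_of_nonneg_right
      (show ‖(r j : k)‖ * ‖Ban.Hom.clm (f₂ j)‖ ≤ 1 by linarith) (norm_nonneg v)
    linarith
  let κ : LimIdx D :=
    { s := s, scal := r, n := fun a => n _ _ a, φ := fun a => φ _ _ a, hφ := fun a => hφ _ _ a
      q := fun a => q _ _ a }
  refine ⟨κ, κ.lift f₁ (fun a => hq₁ _ _ a) hb₁, κ.lift f₂ (fun a => hq₂ _ _ a) hb₂,
    fun j => ?_, fun j => ?_, fun W T₁ T₂ hT => κ.space_ext fun j => ?_⟩
  · exact congrArg (Germ.mk (s j)) (κ.lift_proj f₁ _ _ j)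
  · exact congrArg (Germ.mk (s j)) (κ.lift_proj f₂ _ _ j)
  · rw [Category.assoc, Category.assoc, κ.lift_proj, κ.lift_proj]
    exact hT j

noncomputable instance : SmallCategory (LimIdx D) where
  Hom κ κ' := {T : κ.space ⟶ κ'.space // ∀ j, (κ'.elt j).pre T = κ.elt j}
  id κ := ⟨𝟙 _, fun _ => Germ.pre_id _⟩
  comp T S := ⟨T.1 ≫ S.1, fun j => by rw [← Germ.pre_pre, S.2, T.2]⟩

theorem limIdx_cocone (κ κ' : LimIdx D) :
    ∃ (κ'' : LimIdx D) (_ : κ ⟶ κ'') (_ : κ' ⟶ κ''), True := by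
  choose s f₁ f₂ h₁ h₂ using fun j => Germ.exists_common (κ.elt j) (κ'.elt j)
  obtain ⟨κ'', S₁, S₂, e₁, e₂, -⟩ := exists_limIdx D s f₁ f₂
    (fun a => by rw [h₁, h₁, κ.post_elt]) (fun a => by rw [h₂, h₂, κ'.post_elt])
  exact ⟨κ'', ⟨S₁, fun j => (e₁ j).trans (h₁ j)⟩, ⟨S₂, fun j => (e₂ j).trans (h₂ j)⟩, trivial⟩

/-- If two maps to the spaces `κ.space`, `κ'.space` have the same germs, they become equal. -/
theorem limIdx_coequalize (κ κ' : LimIdx D) {V : Ban c} (T : V ⟶ κ.space) (T' : V ⟶ κ'.space)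
    (h : ∀ j, (κ.elt j).pre T = (κ'.elt j).pre T') :
    ∃ (κ'' : LimIdx D) (S : κ ⟶ κ'') (S' : κ' ⟶ κ''), T ≫ S.1 = T' ≫ S'.1 := by
  have h' := fun j => Germ.mk_eq_mk_iff.1 (h j)
  choose s a b hab using h'
  obtain ⟨κ'', S₁, S₂, e₁, e₂, e⟩ := exists_limIdx D s
    (fun j => κ.proj j ≫ (D.obj j).diag.map (a j)) (fun j => κ'.proj j ≫ (D.obj j).diag.map (b j))
    (fun u => by
      rw [Germ.mk_map, Germ.mk_map]
      exact κ.post_elt u) (fun u => by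
      rw [Germ.mk_map, Germ.mk_map]
      exact κ'.post_elt u)
  refine ⟨κ'', ⟨S₁, fun j => (e₁ j).trans (Germ.mk_map _ _)⟩,
    ⟨S₂, fun j => (e₂ j).trans (Germ.mk_map _ _)⟩, e V T T' fun j => ?_⟩
  rw [← Category.assoc, ← Category.assoc]
  exact hab j

/-- The zero Banach space. -/
def zeroBan (c : BanachConvention k) : Ban c where
  carrier := PUnit.{u + 1}
  admissible := fun _ _ => by
    exact c.op_nonneg le_rfl le_rfl

theorem zeroBan_germ_ext {X : IndDiagram.{u} (Ban c)} (x y : Germ (zeroBan c) X) : x = y := by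
  obtain ⟨j, f, g, rfl, rfl⟩ := Germ.exists_common x y
  refine congrArg (Germ.mk j) (Ban.hom_ext fun v => ?_)
  have e : v = (0 : PUnit.{u + 1}) := rfl
  rw [e]
  exact (map_zero (Ban.Hom.clm f)).trans (map_zero (Ban.Hom.clm g)).symm

instance : IsFiltered (LimIdx D) where
  cocone_objs := limIdx_cocone D
  cocone_maps κ κ' T T' := by
    have h := fun j => Germ.mk_eq_mk_iff.1 ((T.2 j).trans (T'.2 j).symm)
    choose l a b hab using h
    obtain ⟨κ'', S₁, S₂, e₁, -, e⟩ := exists_limIdx D (fun j => IsFiltered.coeq (a j) (b j))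
      (fun j => κ'.proj j ≫ (D.obj j).diag.map (a j ≫ IsFiltered.coeqHom (a j) (b j)))
      (fun j => κ'.proj j ≫ (D.obj j).diag.map (a j ≫ IsFiltered.coeqHom (a j) (b j)))
      (fun u => by
        rw [Germ.mk_map, Germ.mk_map]
        exact κ'.post_elt u) (fun u => by
        rw [Germ.mk_map, Germ.mk_map]
        exact κ'.post_elt u)
    have hS : S₁ = S₂ := by simpa using e _ (𝟙 _) (𝟙 _) fun j => rfl
    refine ⟨κ'', ⟨S₁, fun j => (e₁ j).trans (Germ.mk_map _ _)⟩, Subtype.ext ?_⟩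
    have h := e _ T.1 T'.1 fun j => by
      have h₁ : T.1 ≫ κ'.proj j ≫ (D.obj j).diag.map (a j ≫ IsFiltered.coeqHom (a j) (b j)) =
          ((T.1 ≫ κ'.proj j) ≫ (D.obj j).diag.map (a j)) ≫
            (D.obj j).diag.map (IsFiltered.coeqHom (a j) (b j)) := by
        simp only [Functor.map_comp, Category.assoc]
      have h₂ : T'.1 ≫ κ'.proj j ≫ (D.obj j).diag.map (a j ≫ IsFiltered.coeqHom (a j) (b j)) =
          ((T'.1 ≫ κ'.proj j) ≫ (D.obj j).diag.map (b j)) ≫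
            (D.obj j).diag.map (IsFiltered.coeqHom (a j) (b j)) := by
        rw [IsFiltered.coeq_condition]
        simp only [Functor.map_comp, Category.assoc]
      exact h₁.trans ((congrArg (· ≫ _) (hab j)).trans h₂.symm)
    rw [← hS] at h
    exact h
  nonempty := by
    obtain ⟨κ, -⟩ := exists_limIdx D (V₁ := zeroBan c) (V₂ := zeroBan c)
      (fun j => (IsFiltered.nonempty (C := (D.obj j).Idx)).some)
      (fun j => ⟨0⟩) (fun j => ⟨0⟩) (fun a => zeroBan_germ_ext _ _) (fun a => zeroBan_germ_ext _ _)
    exact ⟨κ⟩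

/-- The limit of `D`. -/
noncomputable def limObj : IndDiagram.{u} (Ban c) where
  Idx := LimIdx D
  diag :=
    { obj := fun κ => κ.space
      map := fun T => T.1 }

/-- The projections of the limit. -/
noncomputable def limπ (j : J) : limObj D ⟶ D.obj j :=
  Hom.mk (fun κ => LimIdx.elt (D := D) κ j) (fun T => T.2 j)

theorem germ_lim_ext {V : Ban c} {x y : Germ V (limObj D)}
    (h : ∀ j, Germ.post (limπ D j) x = Germ.post (limπ D j) y) : x = y := by
  obtain ⟨κ, T, rfl⟩ := x.exists_rep
  obtain ⟨κ', T', rfl⟩ := y.exists_rep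
  obtain ⟨κ'', S, S', e⟩ := limIdx_coequalize D κ κ' T T' h
  exact Germ.mk_eq_mk_iff.2 ⟨κ'', S, S', e⟩

theorem exists_germ_lim {V : Ban c} (b : ∀ j, Germ V (D.obj j))
    (h : ∀ (j j' : J) (a : j ⟶ j'), Germ.post (D.map a) (b j) = b j') :
    ∃ x : Germ V (limObj D), ∀ j, Germ.post (limπ D j) x = b j := by
  choose s f hf using fun j => (b j).exists_rep
  have h' : ∀ {j j' : J} (a : j ⟶ j'), Germ.post (D.map a) (Germ.mk (s j) (f j)) =
      Germ.mk (s j') (f j') := fun a => by rw [← hf, ← hf, h _ _ a]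
  obtain ⟨κ, S, -, e, -, -⟩ := exists_limIdx D s f f h' h'
  exact ⟨Germ.mk (Y := limObj D) κ S, fun j => (e j).trans (hf j).symm⟩

/-- The limit cone. -/
noncomputable def limCone : Cone D where
  pt := limObj D
  π :=
    { app := limπ D
      naturality := fun _ _ a => (Category.id_comp _).trans
        (hom_ext fun κ => (LimIdx.post_elt (D := D) κ a).symm) }

theorem exists_limLift (s : Cone D) : ∃ m : s.pt ⟶ limObj D, ∀ j, m ≫ limπ D j = s.π.app j := by
  have h : ∀ i : s.pt.Idx, ∃ x : Germ (s.pt.diag.obj i) (limObj D),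
      ∀ j, Germ.post (limπ D j) x = Hom.app (s.π.app j) i := fun i =>
    exists_germ_lim D (V := s.pt.diag.obj i) (fun j => Hom.app (X := s.pt) (s.π.app j) i)
      fun j j' a => congrArg (fun t : s.pt ⟶ D.obj j' => Hom.app t i) (s.w a)
  choose x hx using h
  exact ⟨Hom.mk x fun {i i'} a => germ_lim_ext D fun j => by
      rw [Germ.post_pre, hx, hx, Hom.compat], fun j => hom_ext fun i => hx i j⟩

theorem lim_hom_ext {X : IndDiagram.{u} (Ban c)} {f g : X ⟶ limObj D}
    (h : ∀ j, f ≫ limπ D j = g ≫ limπ D j) : f = g :=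
  hom_ext fun i => germ_lim_ext D fun j => congrArg (fun t => Hom.app t i) (h j)

/-- The universal property of the limit cone. -/
noncomputable def limConeIsLimit : IsLimit (limCone D) where
  lift s := (exists_limLift D s).choose
  fac s := (exists_limLift D s).choose_spec
  uniq s _ hm := lim_hom_ext D fun j =>
    (hm j).trans ((exists_limLift D s).choose_spec j).symm

end BanLimits

/-- The category of ind-Banach spaces has all small limits. -/
instance {k : Type u} [NontriviallyNormedField k] {c : BanachConvention k} :
    HasLimitsOfSize.{u, u} (IndDiagram.{u} (Ban c)) where
  has_limits_of_shape _ _ :=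
    { has_limit := fun D => ⟨⟨⟨limCone D, limConeIsLimit D⟩⟩⟩ }

end IndDiagram

section OppositeAssociativity

variable {V : Type u} [Category.{v} V] [MonoidalCategory V]

theorem InternalNat.pull_assoc {E P : V} (p : E ⟶ P) (m : P ⊗ P ⟶ P) (n : E ⊗ E ⟶ E)
    (hn : n ≫ p = (p ⊗ₘ p) ≫ m) (h : m ▷ P ≫ m = (α_ P P P).hom ≫ P ◁ m ≫ m) :
    (n ▷ E ≫ n) ≫ p = ((α_ E E E).hom ≫ E ◁ n ≫ n) ≫ p := by
  have e₁ : n ▷ E ≫ (p ⊗ₘ p) = ((p ⊗ₘ p) ⊗ₘ p) ≫ m ▷ P := by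
    rw [← MonoidalCategory.tensorHom_id, ← MonoidalCategory.tensorHom_id,
      MonoidalCategory.tensorHom_comp_tensorHom, MonoidalCategory.tensorHom_comp_tensorHom, hn,
      Category.id_comp, Category.comp_id]
  have e₂ : E ◁ n ≫ (p ⊗ₘ p) = (p ⊗ₘ (p ⊗ₘ p)) ≫ P ◁ m := by
    rw [← MonoidalCategory.id_tensorHom, ← MonoidalCategory.id_tensorHom,
      MonoidalCategory.tensorHom_comp_tensorHom, MonoidalCategory.tensorHom_comp_tensorHom, hn,
      Category.id_comp, Category.comp_id]
  simp only [Category.assoc]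
  rw [hn, reassoc_of% e₁, reassoc_of% e₂, h, MonoidalCategory.associator_naturality_assoc]

theorem InternalNat.op_assoc [SymmetricCategory V] {X : V} (m : X ⊗ X ⟶ X) (h : m ▷ X ≫ m = (α_ X X X).hom ≫ X ◁ m ≫ m) :
    ((β_ X X).hom ≫ m) ▷ X ≫ (β_ X X).hom ≫ m =
      (α_ X X X).hom ≫ X ◁ ((β_ X X).hom ≫ m) ≫ (β_ X X).hom ≫ m := by
  have h' : X ◁ m ≫ m = (α_ X X X).inv ≫ m ▷ X ≫ m := by rw [h, Iso.inv_hom_id_assoc]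
  have e₁ : m ▷ X ≫ (β_ X X).hom = (β_ (X ⊗ X) X).hom ≫ X ◁ m :=
    BraidedCategory.braiding_naturality_left m X
  have e₂ : X ◁ m ≫ (β_ X X).hom = (β_ X (X ⊗ X)).hom ≫ m ▷ X :=
    BraidedCategory.braiding_naturality_right X m
  have y := BraidedCategory.yang_baxter X X X
  rw [MonoidalCategory.comp_whiskerRight, MonoidalCategory.whiskerLeft_comp, Category.assoc,
    Category.assoc, reassoc_of% e₁, reassoc_of% e₂, h',
    BraidedCategory.braiding_tensor_left_hom, BraidedCategory.braiding_tensor_right_hom]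
  simp only [Category.assoc, Iso.hom_inv_id_assoc]
  rw [← cancel_epi (α_ X X X).inv]
  simp only [Iso.inv_hom_id_assoc]
  have y' := y =≫ ((α_ X X X).inv ≫ m ▷ X ≫ m)
  simp only [Category.assoc, Iso.hom_inv_id_assoc] at y'
  exact y'

end OppositeAssociativity

section InternalNat

universe v₁ u₁ v₂ u₂

variable {J : Type u₁} [Category.{v₁} J] {V : Type u₂} [Category.{v₂} V]
  [MonoidalCategory V] [MonoidalClosed V]

/-- The functor `(j, j') ↦ [F j, G j']`. -/
@[simps]
def internalNatDiagram (F G : J ⥤ V) : Jᵒᵖ ⥤ J ⥤ V where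
  obj j := G ⋙ ihom (F.obj j.unop)
  map a := Functor.whiskerLeft G (MonoidalClosed.pre (F.map a.unop))

/-- The object of internal natural transformations: the equalizer of
`∏_j [F j, G j] ⇉ ∏_{j ⟶ j'} [F j, G j']`. -/
noncomputable def InternalNat (F G : J ⥤ V) [HasEnd (internalNatDiagram F G)] : V :=
  end_ (internalNatDiagram F G)

namespace InternalNat

section Basic

variable (F G : J ⥤ V) [HasEnd (internalNatDiagram F G)]

/-- The component at `j`. -/
noncomputable def π (j : J) : InternalNat F G ⟶ (ihom (F.obj j)).obj (G.obj j) :=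
  end_.π (internalNatDiagram F G) j

theorem π_condition {i j : J} (a : i ⟶ j) :
    π F G i ≫ (ihom (F.obj i)).map (G.map a) =
      π F G j ≫ (MonoidalClosed.pre (F.map a)).app (G.obj j) :=
  end_.condition (internalNatDiagram F G) a

variable {F G}

/-- A compatible family of maps induces a map to the object of internal natural transformations. -/
noncomputable def lift {X : V} (f : ∀ j, X ⟶ (ihom (F.obj j)).obj (G.obj j))
    (h : ∀ {i j : J} (a : i ⟶ j), f i ≫ (ihom (F.obj i)).map (G.map a) =
      f j ≫ (MonoidalClosed.pre (F.map a)).app (G.obj j)) : X ⟶ InternalNat F G :=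
  end_.lift (F := internalNatDiagram F G) f fun _ _ a => h a

theorem lift_π {X : V} (f : ∀ j, X ⟶ (ihom (F.obj j)).obj (G.obj j)) (h) (j : J) :
    lift (F := F) (G := G) f h ≫ π F G j = f j :=
  end_.lift_π (F := internalNatDiagram F G) f _ j

theorem hom_ext {X : V} {f g : X ⟶ InternalNat F G} (h : ∀ j, f ≫ π F G j = g ≫ π F G j) :
    f = g :=
  end_.hom_ext (F := internalNatDiagram F G) h

end Basic

section Composition

open MonoidalClosed

theorem comp_map (x y : V) {z z' : V} (g : z ⟶ z') :
    comp x y z ≫ (ihom x).map g = ((ihom x).obj y ◁ (ihom y).map g) ≫ comp x y z' := by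
  apply uncurry_injective
  rw [uncurry_natural_right, uncurry_natural_left, comp_eq, comp_eq, uncurry_curry, uncurry_curry,
    compTranspose_eq, compTranspose_eq, associator_inv_naturality_right_assoc,
    whisker_exchange_assoc]
  simp

theorem comp_pre {x x' : V} (f : x ⟶ x') (y z : V) :
    comp x' y z ≫ (pre f).app z = ((pre f).app y ▷ (ihom y).obj z) ≫ comp x y z := by
  have h : curry (f ▷ _ ≫ compTranspose x' y z) = comp x' y z ≫ (pre f).app z := by
    rw [comp_eq, curry_pre_app]
  rw [← h]
  apply uncurry_injective
  rw [uncurry_natural_left, comp_eq, uncurry_curry, uncurry_curry, compTranspose_eq,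
    compTranspose_eq, associator_inv_naturality_middle_assoc, ← comp_whiskerRight_assoc,
    id_tensor_pre_app_comp_ev]
  simp

theorem comp_middle (x z : V) {y y' : V} (g : y ⟶ y') :
    ((ihom x).map g ▷ (ihom y').obj z) ≫ comp x y' z =
      ((ihom x).obj y ◁ (pre g).app z) ≫ comp x y z := by
  apply uncurry_injective
  rw [uncurry_natural_left, uncurry_natural_left, comp_eq, comp_eq, uncurry_curry, uncurry_curry,
    compTranspose_eq, compTranspose_eq, associator_inv_naturality_middle_assoc,
    associator_inv_naturality_right_assoc, ← comp_whiskerRight_assoc, whisker_exchange_assoc]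
  dsimp only [Functor.id_obj]
  rw [id_tensor_pre_app_comp_ev]
  simp

end Composition

section Algebra

variable (F : J ⥤ V) [HasEnd (internalNatDiagram F F)]

/-- The unit of the object of internal endomorphisms of `F`: its components are the identities. -/
noncomputable def one : 𝟙_ V ⟶ InternalNat F F :=
  lift (fun j => MonoidalClosed.id (F.obj j)) fun a => by
    rw [MonoidalClosed.id_eq, MonoidalClosed.id_eq, MonoidalClosed.curry_pre_app,
      ← MonoidalClosed.curry_natural_right, rightUnitor_naturality]

theorem one_π (j : J) : one F ≫ π F F j = MonoidalClosed.id (F.obj j) := lift_π _ _ j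

variable [SymmetricCategory V]

theorem mul_compat {i j : J} (a : i ⟶ j) :
    ((π F F i ⊗ₘ π F F i) ≫ (β_ _ _).hom ≫
        MonoidalClosed.comp (F.obj i) (F.obj i) (F.obj i)) ≫ (ihom (F.obj i)).map (F.map a) =
      ((π F F j ⊗ₘ π F F j) ≫ (β_ _ _).hom ≫
        MonoidalClosed.comp (F.obj j) (F.obj j) (F.obj j)) ≫
        (MonoidalClosed.pre (F.map a)).app (F.obj j) := by
  have h := π_condition F F a
  rw [BraidedCategory.braiding_naturality_assoc, BraidedCategory.braiding_naturality_assoc]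
  simp only [Category.assoc]
  rw [comp_map, comp_pre]
  congr 1
  have h₁ : (π F F i ⊗ₘ π F F i) ≫ (ihom (F.obj i)).obj (F.obj i) ◁
      (ihom (F.obj i)).map (F.map a) =
        (π F F i ▷ _) ≫ (_ ◁ π F F j) ≫ (_ ◁ (MonoidalClosed.pre (F.map a)).app (F.obj j)) := by
    rw [MonoidalCategory.tensorHom_def, Category.assoc, ← MonoidalCategory.whiskerLeft_comp, h,
      MonoidalCategory.whiskerLeft_comp]
  have h₂ : (π F F j ⊗ₘ π F F j) ≫ ((MonoidalClosed.pre (F.map a)).app (F.obj j) ▷ _) =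
      (π F F i ▷ _) ≫ (_ ◁ π F F j) ≫ ((ihom (F.obj i)).map (F.map a) ▷ _) := by
    rw [tensorHom_def', Category.assoc, ← MonoidalCategory.comp_whiskerRight, ← h,
      MonoidalCategory.comp_whiskerRight, whisker_exchange_assoc]
  rw [reassoc_of% h₁, reassoc_of% h₂, comp_middle]

/-- The multiplication of the object of internal endomorphisms of `F`, given on components by
`f ⊗ g ↦ f ∘ g`. -/
noncomputable def mul : InternalNat F F ⊗ InternalNat F F ⟶ InternalNat F F :=
  lift (fun j => (π F F j ⊗ₘ π F F j) ≫ (β_ _ _).hom ≫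
    MonoidalClosed.comp (F.obj j) (F.obj j) (F.obj j)) fun a => mul_compat F a

theorem mul_π (j : J) : mul F ≫ π F F j = (π F F j ⊗ₘ π F F j) ≫ (β_ _ _).hom ≫
    MonoidalClosed.comp (F.obj j) (F.obj j) (F.obj j) := lift_π _ _ j

theorem op_comp_assoc (x : V) :
    ((β_ _ _).hom ≫ MonoidalClosed.comp x x x) ▷ (ihom x).obj x ≫
        (β_ _ _).hom ≫ MonoidalClosed.comp x x x =
      (α_ _ _ _).hom ≫ (ihom x).obj x ◁ ((β_ _ _).hom ≫ MonoidalClosed.comp x x x) ≫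
        (β_ _ _).hom ≫ MonoidalClosed.comp x x x :=
  op_assoc _ (by rw [← MonoidalClosed.assoc, Iso.hom_inv_id_assoc])

/-- Internal endomorphisms form an algebra. -/
noncomputable instance : MonObj (InternalNat F F) where
  one := one F
  mul := mul F
  one_mul := hom_ext fun j => by
    have h := MonoidalClosed.comp_id (F.obj j) (F.obj j)
    rw [Iso.inv_comp_eq, Category.comp_id] at h
    rw [Category.assoc, mul_π, MonoidalCategory.tensorHom_def, Category.assoc,
      ← MonoidalCategory.comp_whiskerRight_assoc, one_π, ← whisker_exchange_assoc,
      BraidedCategory.braiding_naturality_left_assoc, h, braiding_rightUnitor,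
      leftUnitor_naturality]
  mul_one := hom_ext fun j => by
    have h := MonoidalClosed.id_comp (F.obj j) (F.obj j)
    rw [Iso.inv_comp_eq, Category.comp_id] at h
    rw [Category.assoc, mul_π, tensorHom_def', Category.assoc,
      ← MonoidalCategory.whiskerLeft_comp_assoc, one_π, whisker_exchange_assoc,
      BraidedCategory.braiding_naturality_right_assoc, h, braiding_leftUnitor,
      rightUnitor_naturality]
  mul_assoc := hom_ext fun j => pull_assoc _ _ _ (mul_π F j) (op_comp_assoc (F.obj j))

end Algebra

end InternalNat

end InternalNat

/-- The category `IndBan_k` of ind-Banach spaces over `k`. -/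
abbrev IndBan {k : Type u} [NontriviallyNormedField k] (c : BanachConvention k) : Type (u + 1) :=
  IndDiagram.{u} (Ban c)

/-- The map `A ⟶ [M, M]` corresponding to the action `A ⊗ M ⟶ M` of an algebra `A` on a left
module `M`. -/
noncomputable def actionMap {V : Type u} [Category.{v} V] [MonoidalCategory V]
    [SymmetricCategory V] [MonoidalClosed V] (A : V) [MonObj A] (M : Mod V A) :
    A ⟶ (ihom M.X).obj M.X :=
  MonoidalClosed.curry ((β_ M.X A).hom ≫ ModObj.smul (M := A) (X := M.X))

/-!
The action maps `A ⟶ [M, M]` form a universal wedge. Given a compatible family `f M : X ⟶ [M, M]`,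
evaluating the transpose `A ⊗ X ⟶ A` of its component at the regular module at the unit of `A` gives
`φ : X ⟶ A`, and the point is that `f M` is `φ` followed by the action map
(`evalOne_comp_actionMap`). Restricting the transpose `(A ⊗ N) ⊗ X ⟶ A ⊗ N` of `f` at the free
module `A ⊗ N` to the generators `N` gives maps `N ⊗ X ⟶ A ⊗ N` natural in the object `N`. They
determine `f`, since every module `M` receives the module map `A ⊗ M ⟶ M` which is split by the unit.
The maps `N ⊗ X ⟶ A ⊗ N` built from `φ` and the symmetry are natural as well and coincide with these
for `N = 1`, so it suffices that such natural families are determined by their value at `N = 1`.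

For the enriched notion of naturality this would be formal, but the end only sees the underlying
ordinary category of modules, and the unit is not a generator of the category of ind-Banach spaces:
a map from a Banach space `B` to a formal colimit can vanish on each element of `B`, at a stage
depending on the element, without vanishing. Naturality in all ind-Banach spaces nevertheless
suffices (`IndDiagram.eq_of_natural_of_unit`). This reduces to Banach spaces `N = B`. Let `P` be the Banach
space of bounded families in `B` indexed by the set `J` of transition maps of `A`. Two natural
families that agree at `k` agree on each `ω ⊗ w` with `ω` in `P`, after a transition map `c(ω)` in
`J`. There is `q` in `J` such that every `b` in the unit ball of `B` is the coordinate `ω(q)` of some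
`ω` with `c(ω) = q`: otherwise a choice of a missing value `b_q` for each `q` would be a point `ω` of
`P` that contradicts the existence of `c(ω)`. Naturality along the `q`-th projection `P ⟶ B` then
shows that the two families at `B` agree on all `b ⊗ w` at one common stage. Unlike an argument with
free Banach spaces, this works uniformly for both conventions, as supremum norms are admissible in
either.
-/

/-! ### Free modules over a monoid object -/

section Reconstruction

open MonoidalClosed MonObj

variable {V : Type u} [Category.{v} V] [MonoidalCategory V]

namespace Mod

/-- The free `A`-module `A ⊗ N`. -/
def free (A : V) [MonObj A] (N : V) : Mod V A where
  X := A ⊗ N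
  mod :=
    { smul := (α_ A A N).inv ≫ μ ▷ N
      one_smul := by
        change η ▷ (A ⊗ N) ≫ (α_ A A N).inv ≫ μ ▷ N = (λ_ (A ⊗ N)).hom
        simp [← comp_whiskerRight]
      mul_smul := by
        change μ ▷ (A ⊗ N) ≫ (α_ A A N).inv ≫ μ ▷ N =
          (α_ A A (A ⊗ N)).hom ≫ A ◁ ((α_ A A N).inv ≫ μ ▷ N) ≫ (α_ A A N).inv ≫ μ ▷ N
        rw [whiskerLeft_comp, associator_inv_naturality_left_assoc, ← comp_whiskerRight, mul_assoc]
        simp }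

/-- Functoriality of the free module. -/
def freeMap (A : V) [MonObj A] {N N' : V} (f : N ⟶ N') : free A N ⟶ free A N' :=
  Mod.Hom.mk' (M := free A N) (N := free A N') (A ◁ f) (by
    change ((α_ A A N).inv ≫ μ ▷ N) ≫ A ◁ f = A ◁ A ◁ f ≫ (α_ A A N').inv ≫ μ ▷ N'
    rw [Category.assoc, ← whisker_exchange, associator_inv_naturality_right_assoc])

/-- The action `A ⊗ M ⟶ M` as a map of modules out of a free one. -/
def freeDesc (A : V) [MonObj A] (M : Mod V A) : free A M.X ⟶ M :=
  Mod.Hom.mk' (M := free A M.X) (N := M) (ModObj.smul (M := A) (X := M.X))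
    ((ModObj.mul_smul_self_flip (M := A) M.X).trans (Category.assoc _ _ _).symm).symm

/-- The free module on the unit is the regular module. -/
def freeUnit (A : V) [MonObj A] : free A (𝟙_ V) ⟶ Mod.regular A :=
  Mod.Hom.mk' (M := free A (𝟙_ V)) (N := Mod.regular A) (ρ_ A).hom (by
    change ((α_ A A (𝟙_ V)).inv ≫ μ ▷ 𝟙_ V) ≫ (ρ_ A).hom = A ◁ (ρ_ A).hom ≫ μ
    simp)

end Mod

/-! ### Action maps and compatible families -/

variable {A : V} [MonObj A] {X : V}

/-- The restriction along the unit of `A` of a map `A ⊗ X ⟶ A`. -/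
def evalOne (t : A ⊗ X ⟶ A) : X ⟶ A := (λ_ X).inv ≫ η ▷ X ≫ t

/-- The restriction to the generators `N` of the free module of a map `(A ⊗ N) ⊗ X ⟶ A ⊗ N`. -/
def evalFree {N : V} (t : (A ⊗ N) ⊗ X ⟶ A ⊗ N) : N ⊗ X ⟶ A ⊗ N :=
  (λ_ N).inv ▷ X ≫ (η ▷ N) ▷ X ≫ t

theorem evalFree_naturality {N N' : V} (g : N ⟶ N') {t : (A ⊗ N) ⊗ X ⟶ A ⊗ N}
    {t' : (A ⊗ N') ⊗ X ⟶ A ⊗ N'} (h : t ≫ A ◁ g = (A ◁ g) ▷ X ≫ t') :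
    evalFree t ≫ A ◁ g = g ▷ X ≫ evalFree t' := by
  rw [evalFree, evalFree, Category.assoc, Category.assoc, h, ← comp_whiskerRight_assoc,
    ← comp_whiskerRight_assoc, ← comp_whiskerRight_assoc, ← comp_whiskerRight_assoc,
    Category.assoc, ← whisker_exchange, ← leftUnitor_inv_naturality_assoc, Category.assoc]

theorem evalFree_comp_smul {M : V} [ModObj A M] {t : (A ⊗ M) ⊗ X ⟶ A ⊗ M} {t' : M ⊗ X ⟶ M}
    (h : t ≫ ModObj.smul (M := A) (X := M) = ModObj.smul (M := A) (X := M) ▷ X ≫ t') :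
    evalFree t ≫ ModObj.smul (M := A) (X := M) = t' := by
  rw [evalFree, Category.assoc, Category.assoc, h, ← comp_whiskerRight_assoc,
    ← comp_whiskerRight_assoc, Category.assoc, ModObj.one_smul_self, Iso.inv_hom_id,
    id_whiskerRight, Category.id_comp]

variable [SymmetricCategory V]

theorem evalFree_unit {t : (A ⊗ 𝟙_ V) ⊗ X ⟶ A ⊗ 𝟙_ V} {t' : A ⊗ X ⟶ A}
    (h : t ≫ (ρ_ A).hom = (ρ_ A).hom ▷ X ≫ t') :
    evalFree t = 𝟙_ V ◁ evalOne t' ≫ (β_ (𝟙_ V) A).hom := by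
  rw [← cancel_mono (ρ_ A).hom, evalFree, Category.assoc, Category.assoc, h, Category.assoc,
    braiding_rightUnitor, leftUnitor_naturality, evalOne, Iso.hom_inv_id_assoc,
    ← comp_whiskerRight_assoc, ← comp_whiskerRight_assoc, Category.assoc, rightUnitor_naturality,
    ← unitors_equal, Iso.inv_hom_id_assoc]

variable [MonoidalClosed V]

section ActionMap

variable (A)

theorem uncurry_actionMap (M : Mod V A) :
    uncurry (actionMap A M) = (β_ M.X A).hom ≫ ModObj.smul (M := A) (X := M.X) :=
  uncurry_curry _

theorem uncurry_comp_actionMap (φ : X ⟶ A) (M : Mod V A) :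
    uncurry (φ ≫ actionMap A M) =
      M.X ◁ φ ≫ (β_ M.X A).hom ≫ ModObj.smul (M := A) (X := M.X) := by
  rw [uncurry_natural_left, uncurry_actionMap]

theorem actionMap_natural {M N : Mod V A} (f : M ⟶ N) :
    actionMap A M ≫ (ihom M.X).map f.hom = actionMap A N ≫ (pre f.hom).app N.X := by
  have h : ModObj.smul (M := A) (X := M.X) ≫ f.hom =
      A ◁ f.hom ≫ ModObj.smul (M := A) (X := N.X) := IsModHom.smul_hom (A := A) (f := f.hom)
  rw [actionMap, actionMap, curry_pre_app, ← curry_natural_right,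
    BraidedCategory.braiding_naturality_left_assoc, Category.assoc, h]

theorem one_actionMap (M : Mod V A) : η ≫ actionMap A M = MonoidalClosed.id M.X := by
  apply uncurry_injective
  rw [uncurry_comp_actionMap, MonoidalClosed.id_eq, uncurry_curry,
    BraidedCategory.braiding_naturality_right_assoc, ModObj.one_smul_self, braiding_leftUnitor]

theorem mul_actionMap (M : Mod V A) :
    μ ≫ actionMap A M =
      (actionMap A M ⊗ₘ actionMap A M) ≫ (β_ _ _).hom ≫ MonoidalClosed.comp M.X M.X M.X := by
  apply uncurry_injective
  -- Transposing the composite braids `A` past `A` twice: by naturality of the braiding of `M.X` with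
  -- `A ⊗ A` and symmetry, the two crossings cancel.
  have h : M.X ◁ (β_ A A).hom ≫ (β_ M.X (A ⊗ A)).hom =
      (β_ M.X (A ⊗ A)).hom ≫ (β_ A A).hom ▷ M.X :=
    BraidedCategory.braiding_naturality_right _ _
  have h' := h =≫ ((β_ A A).hom ▷ M.X)
  rw [Category.assoc, Category.assoc, ← comp_whiskerRight, SymmetricCategory.symmetry,
    id_whiskerRight, Category.comp_id] at h'
  have e : M.X ◁ actionMap A M ≫ (ihom.ev M.X).app M.X =
      (β_ M.X A).hom ≫ ModObj.smul (M := A) (X := M.X) := by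
    rw [← uncurry_eq, uncurry_actionMap]
  have e₁ : uncurry ((actionMap A M ⊗ₘ actionMap A M) ≫ MonoidalClosed.comp M.X M.X M.X) =
      (α_ M.X A A).inv ≫ ((β_ M.X A).hom ≫ ModObj.smul (M := A) (X := M.X)) ▷ A ≫
        (β_ M.X A).hom ≫ ModObj.smul (M := A) (X := M.X) := by
    rw [uncurry_natural_left, MonoidalClosed.comp_eq, uncurry_curry,
      MonoidalClosed.compTranspose_eq, MonoidalCategory.tensorHom_def,
      MonoidalCategory.whiskerLeft_comp, Category.assoc, associator_inv_naturality_right_assoc, whisker_exchange_assoc,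
      associator_inv_naturality_middle_assoc, ← comp_whiskerRight_assoc, e]
    dsimp only [Functor.id_obj]
    rw [e]
  rw [uncurry_comp_actionMap, BraidedCategory.braiding_naturality_right_assoc,
    ModObj.mul_smul_self, BraidedCategory.braiding_naturality_assoc, uncurry_natural_left, e₁,
    ← h', comp_whiskerRight, Category.assoc, Category.assoc, Category.assoc,
    BraidedCategory.braiding_naturality_left_assoc, BraidedCategory.braiding_tensor_left_hom,
    BraidedCategory.braiding_tensor_right_hom]
  simp only [Category.assoc]

end ActionMap

theorem evalOne_actionMap (ψ : X ⟶ A) :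
    evalOne (A := A) (uncurry (ψ ≫ actionMap A (Mod.regular A))) = ψ := by
  have h : uncurry (ψ ≫ actionMap A (Mod.regular A)) = A ◁ ψ ≫ (β_ A A).hom ≫ μ :=
    uncurry_comp_actionMap A ψ (Mod.regular A)
  refine (congrArg (evalOne (A := A)) h).trans ?_
  rw [evalOne, ← whisker_exchange_assoc, BraidedCategory.braiding_naturality_left_assoc,
    MonObj.mul_one, braiding_rightUnitor, leftUnitor_naturality, Iso.inv_hom_id_assoc]

/-- A compatible family `X ⟶ [M, M]` factors through the action maps, provided that natural
families `N ⊗ X ⟶ A ⊗ N` are determined by their value at the unit. -/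
theorem evalOne_comp_actionMap
    (hA : ∀ t t' : ∀ N : V, N ⊗ X ⟶ A ⊗ N,
      (∀ {N N' : V} (g : N ⟶ N'), t N ≫ A ◁ g = g ▷ X ≫ t N') →
      (∀ {N N' : V} (g : N ⟶ N'), t' N ≫ A ◁ g = g ▷ X ≫ t' N') →
      t (𝟙_ V) = t' (𝟙_ V) → ∀ N, t N = t' N)
    (f : ∀ M : Mod V A, X ⟶ (ihom M.X).obj M.X)
    (hf : ∀ {M N : Mod V A} (a : M ⟶ N),
      f M ≫ (ihom M.X).map a.hom = f N ≫ (pre a.hom).app N.X) (M : Mod V A) :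
    evalOne (A := A) (uncurry (f (Mod.regular A))) ≫ actionMap A M = f M := by
  have ht {M N : Mod V A} (a : M ⟶ N) : uncurry (f M) ≫ a.hom = a.hom ▷ X ≫ uncurry (f N) := by
    rw [← uncurry_natural_right, hf a, uncurry_pre_app]
  have key := hA (fun N => evalFree (uncurry (f (Mod.free A N))))
    (fun N => N ◁ evalOne (A := A) (uncurry (f (Mod.regular A))) ≫ (β_ N A).hom)
    (fun g => evalFree_naturality g (ht (Mod.freeMap A g)))
    (fun g => by
      rw [Category.assoc, ← BraidedCategory.braiding_naturality_left, whisker_exchange_assoc])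
    (evalFree_unit (ht (Mod.freeUnit A))) M.X
  apply uncurry_injective
  rw [uncurry_comp_actionMap, ← evalFree_comp_smul (ht (Mod.freeDesc A M))]
  exact (Category.assoc _ _ _).symm.trans
    (congrArg (· ≫ ModObj.smul (M := A) (X := M.X)) key.symm)

end Reconstruction

/-! ### Constant ind-objects -/

namespace IndDiagram

section Const

variable {C : Type u} [Category.{v} C]

/-- An object of `C` as an ind-object: the singleton diagram. For `B = 𝟙_ C` this is, definitionally,
the unit of the monoidal structure on ind-objects. -/
abbrev constObj (B : C) : IndDiagram.{v} C where
  Idx := Discrete PUnit.{v + 1}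
  diag :=
    { obj := fun _ => B
      map := fun _ => 𝟙 _ }

/-- The map of ind-objects out of a constant one given by a morphism to one stage. -/
def constDesc {B : C} {Y : IndDiagram.{v} C} (j : Y.Idx) (f : B ⟶ Y.diag.obj j) :
    constObj B ⟶ Y :=
  Hom.mk (X := constObj B) (fun _ => Germ.mk j f) (fun _ => Germ.pre_id _)

variable [MonoidalCategory C]

theorem whiskerRight_constDesc_comp_app {B : C} {Y X Z : IndDiagram.{v} C} (j : Y.Idx)
    (f : B ⟶ Y.diag.obj j) (t : Y ⊗ X ⟶ Z) (i : (constObj B).Idx) (x : X.Idx) :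
    Hom.app (X := constObj B ⊗ X) (constDesc j f ▷ X ≫ t) (i, x) =
      (Hom.app (X := Y ⊗ X) t (j, x)).pre (f ▷ X.diag.obj x) :=
  congrArg (fun g => (Hom.app (X := Y ⊗ X) t (j, x)).pre g)
    (MonoidalCategory.tensorHom_id f (X.diag.obj x))

theorem germ_post_whiskerLeft_constDesc {B W : C} {A Y : IndDiagram.{v} C} (j : Y.Idx)
    (f : B ⟶ Y.diag.obj j) (p : (A ⊗ constObj B).Idx) (F : W ⟶ (A ⊗ constObj B).diag.obj p) :
    Germ.post (A ◁ constDesc j f) (Germ.mk (Y := A ⊗ constObj B) p F) =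
      Germ.mk (Y := A ⊗ Y) (p.1, j) (F ≫ A.diag.obj p.1 ◁ f) :=
  congrArg (fun g => Germ.mk (Y := A ⊗ Y) (p.1, j) (F ≫ g))
    (MonoidalCategory.id_tensorHom (A.diag.obj p.1) f)

end Const

end IndDiagram

/-! ### Bounded families and elementary tensors in Banach spaces -/

namespace Ban

variable {k : Type u} [NontriviallyNormedField k] {c : BanachConvention k}

/-- The Banach space of bounded families in `B` indexed by `J`, with the supremum norm, which is
admissible for both conventions. -/
noncomputable def boundedFamilies (J : Type u) (B : Ban c) : Ban c where
  carrier := lp (fun _ : J => (B : Type u)) ⊤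
  admissible := fun x y => by
    refine lp.norm_le_of_forall_le (c.op_nonneg (norm_nonneg x) (norm_nonneg y)) fun j => ?_
    refine (B.admissible _ _).trans (c.op_mono ?_ ?_)
    · exact lp.norm_apply_le_norm (by simp) x j
    · exact lp.norm_apply_le_norm (by simp) y j

/-- The `j`-th coordinate of a bounded family. -/
noncomputable def boundedFamilies.proj {J : Type u} (B : Ban c) (j : J) :
    boundedFamilies J B ⟶ B :=
  ⟨LinearMap.mkContinuous
    { toFun := fun x : lp (fun _ : J => (B : Type u)) ⊤ => x j
      map_add' := fun _ _ => rfl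
      map_smul' := fun _ _ => rfl } 1
    (fun x => by rw [one_mul]; exact lp.norm_apply_le_norm (by simp) x j)⟩

/-- A family in the unit ball of `B`. -/
noncomputable def boundedFamilies.mk {J : Type u} (B : Ban c) (s : J → B) (hs : ∀ j, ‖s j‖ ≤ 1) :
    boundedFamilies J B :=
  (⟨s, memℓp_infty ⟨1, by rintro _ ⟨j, rfl⟩; exact hs j⟩⟩ : lp (fun _ : J => (B : Type u)) ⊤)

theorem boundedFamilies.proj_mk {J : Type u} (B : Ban c) (s : J → B) (hs : ∀ j, ‖s j‖ ≤ 1)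
    (j : J) : Hom.clm (boundedFamilies.proj B j) (boundedFamilies.mk B s hs) = s j := rfl

variable [CompleteSpace k]

/-- The map `k ⟶ P` with value `ω` at `1`. -/
noncomputable def ofElement {P : Ban c} (ω : P) : 𝟙_ (Ban c) ⟶ P :=
  ⟨(ContinuousLinearMap.lsmul k k).flip ω⟩

theorem ofElement_one {P : Ban c} (ω : P) : Hom.clm (ofElement ω) (1 : k) = ω := one_smul k ω

theorem whiskerRight_pure {V W : Ban c} (f : V ⟶ W) (X : Ban c) (v : V) (x : X) :
    Hom.clm (f ▷ X) (pure V X v x) = pure W X (Hom.clm f v) x := tensMap_pure f (𝟙 X) v x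

/-- Maps out of `B ⊗ W` are determined by the elements `b ⊗ w` with `b` in the unit ball. -/
theorem tensor_hom_ext_of_norm_le_one {B W Z : Ban c} {f g : B ⊗ W ⟶ Z}
    (h : ∀ (b : B) (w : W), ‖b‖ ≤ 1 → Hom.clm f (pure B W b w) = Hom.clm g (pure B W b w)) :
    f = g := by
  refine tens_ext fun b w => ?_
  obtain ⟨r, hr, hr'⟩ := NormedField.exists_norm_lt k (show 0 < (‖b‖ + 1)⁻¹ by positivity)
  have hb : ‖r • b‖ ≤ 1 := by
    rw [norm_smul]
    calc ‖r‖ * ‖b‖ ≤ (‖b‖ + 1)⁻¹ * (‖b‖ + 1) := by gcongr; linarith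
      _ = 1 := inv_mul_cancel₀ (by positivity)
  have e := h (r • b) w hb
  have e' : pure B W (r • b) w = r • pure B W b w := by
    rw [map_smul]; rfl
  rw [e', map_smul, map_smul] at e
  exact smul_right_injective _ (norm_pos_iff.1 hr) e

end Ban

/-! ### Natural families of maps of ind-Banach spaces -/

namespace IndDiagram

variable {k : Type u} [NontriviallyNormedField k] [CompleteSpace k] {c : BanachConvention k}

/-- Germs `B ⊗ W ⟶ A ⊗ B` natural in the Banach space `B` are determined by the one at `B = k`.
Naturality along `k ⟶ B` shows that two such germs agree on each `b ⊗ w`, but at a stage of `A`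
depending on `b`. A common stage is found by applying this to the Banach space of bounded families
in `B` indexed by all transition maps of `A`, followed by a diagonal argument. -/
theorem germ_eq_of_natural_of_unit {A : IndDiagram.{u} (Ban c)} {W : Ban c}
    (τ τ' : ∀ B : Ban c, Germ (B ⊗ W) (A ⊗ constObj B))
    (hτ : ∀ {B B' : Ban c} (f : B ⟶ B'),
      Germ.post (A ◁ constDesc (Y := constObj B') ⟨⟨⟩⟩ f) (τ B) = (τ B').pre (f ▷ W))
    (hτ' : ∀ {B B' : Ban c} (f : B ⟶ B'),
      Germ.post (A ◁ constDesc (Y := constObj B') ⟨⟨⟩⟩ f) (τ' B) = (τ' B').pre (f ▷ W))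
    (h : τ (𝟙_ (Ban c)) = τ' (𝟙_ (Ban c))) (B : Ban c) : τ B = τ' B := by
  -- Indexing by all transition maps, rather than those out of the stage `i` below, is needed because
  -- `i` depends on `P` and hence on `J`.
  let J : Type u := Σ (j : A.Idx) (l : A.Idx), (j ⟶ l)
  let P : Ban c := Ban.boundedFamilies J B
  obtain ⟨⟨i, ⟨⟨⟩⟩⟩, F, F', hF, hF'⟩ := Germ.exists_common (τ P) (τ' P)
  obtain ⟨⟨i₀, ⟨⟨⟩⟩⟩, f, f', hf, hf'⟩ := Germ.exists_common (τ B) (τ' B)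
  -- `Agree q ω`: the transition map `q` identifies the values of `F` and `F'` on all `ω ⊗ w`.
  let Agree (q : J) (ω : P) : Prop := ∃ (l : A.Idx) (a : i ⟶ l), q = ⟨i, l, a⟩ ∧
    ∀ w : W, Ban.Hom.clm (A.diag.map a ▷ P) (Ban.Hom.clm F (Ban.pure P W ω w)) =
      Ban.Hom.clm (A.diag.map a ▷ P) (Ban.Hom.clm F' (Ban.pure P W ω w))
  have hagree : ∀ ω : P, ∃ q, Agree q ω := by
    intro ω
    have e : (τ P).pre (Ban.ofElement ω ▷ W) = (τ' P).pre (Ban.ofElement ω ▷ W) := by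
      rw [← hτ, ← hτ', h]
    rw [← hF, ← hF', Germ.pre_mk, Germ.pre_mk, Germ.mk_eq_mk_iff] at e
    obtain ⟨⟨l, ⟨⟨⟩⟩⟩, ⟨a, _⟩, ⟨b, _⟩, e⟩ := e
    refine ⟨⟨i, _, a ≫ IsFiltered.coeqHom a b⟩, _, _, rfl, fun w => ?_⟩
    have e₁ : (Ban.ofElement ω ▷ W ≫ F) ≫ A.diag.map a ▷ P =
        (Ban.ofElement ω ▷ W ≫ F') ≫ A.diag.map b ▷ P := e
    have e₂ : (Ban.ofElement ω ▷ W ≫ F) ≫ A.diag.map (a ≫ IsFiltered.coeqHom a b) ▷ P =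
        (Ban.ofElement ω ▷ W ≫ F') ≫ A.diag.map (a ≫ IsFiltered.coeqHom a b) ▷ P := by
      conv_rhs => rw [IsFiltered.coeq_condition]
      rw [Functor.map_comp, Functor.map_comp, comp_whiskerRight, comp_whiskerRight]
      exact (Category.assoc _ _ _).symm.trans ((congrArg (· ≫ _) e₁).trans (Category.assoc _ _ _))
    have e₃ := DFunLike.congr_fun (congrArg Ban.Hom.clm e₂) (Ban.pure (Ban.unit c) W (1 : k) w)
    have e₄ : Ban.Hom.clm (Ban.ofElement ω ▷ W) (Ban.pure (Ban.unit c) W (1 : k) w) =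
        Ban.pure P W ω w :=
      (Ban.whiskerRight_pure _ _ _ _).trans
        (congrArg (fun v => Ban.pure P W v w) (Ban.ofElement_one ω))
    simp only [Ban.comp_clm, ContinuousLinearMap.comp_apply] at e₃
    rw [e₄] at e₃
    exact e₃
  -- A diagonal argument: a family of counterexamples, one for each `q`, would itself be a point
  -- `ω` of the unit ball of `P` violating `hagree`.
  obtain ⟨q, hq⟩ : ∃ q : J, ∀ b : B, ‖b‖ ≤ 1 →
      ∃ ω : P, Ban.Hom.clm (Ban.boundedFamilies.proj B q) ω = b ∧ Agree q ω := by
    by_contra! hne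
    choose s hs hs' using hne
    obtain ⟨q, hq⟩ := hagree (Ban.boundedFamilies.mk B s hs)
    exact hs' q _ (Ban.boundedFamilies.proj_mk B s hs q) hq
  obtain ⟨_, -, l, a, rfl, -⟩ := hq 0 (by simp)
  have hq' : ∀ b : B, ‖b‖ ≤ 1 → ∃ ω : P, Ban.Hom.clm (Ban.boundedFamilies.proj B ⟨i, l, a⟩) ω = b ∧
      ∀ w : W, Ban.Hom.clm (A.diag.map a ▷ P) (Ban.Hom.clm F (Ban.pure P W ω w)) =
        Ban.Hom.clm (A.diag.map a ▷ P) (Ban.Hom.clm F' (Ban.pure P W ω w)) := by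
    intro b hb
    obtain ⟨ω, hω, l', a', e, hA⟩ := hq b hb
    cases e
    exact ⟨ω, hω, hA⟩
  set p : P ⟶ B := Ban.boundedFamilies.proj B ⟨i, l, a⟩
  -- Naturality along the projection `p` compares the germs at `P` and `B`.
  have key : ∀ (σ : ∀ B : Ban c, Germ (B ⊗ W) (A ⊗ constObj B))
      (_ : ∀ {B B' : Ban c} (f : B ⟶ B'),
        Germ.post (A ◁ constDesc (Y := constObj B') ⟨⟨⟩⟩ f) (σ B) = (σ B').pre (f ▷ W))
      (G : P ⊗ W ⟶ A.diag.obj i ⊗ P) (g : B ⊗ W ⟶ A.diag.obj i₀ ⊗ B)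
      (_ : Germ.mk (Y := A ⊗ constObj P) (i, ⟨⟨⟩⟩) G = σ P)
      (_ : Germ.mk (Y := A ⊗ constObj B) (i₀, ⟨⟨⟩⟩) g = σ B),
      ∃ (m : A.Idx) (α : l ⟶ m) (β : i₀ ⟶ m), (G ≫ A.diag.map a ▷ P ≫ A.diag.obj l ◁ p) ≫
        A.diag.map α ▷ B = (p ▷ W ≫ g) ≫ A.diag.map β ▷ B := by
    intro σ hσ G g hG hg
    have e := hσ p
    rw [← hG, ← hg, germ_post_whiskerLeft_constDesc, Germ.pre_mk,
      ← Germ.mk_map (Y := A ⊗ constObj B) (j := (i, ⟨⟨⟩⟩)) (j' := (l, ⟨⟨⟩⟩)) _ (a, 𝟙 _),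
      Germ.mk_eq_mk_iff] at e
    obtain ⟨⟨m, ⟨⟨⟩⟩⟩, ⟨α, _⟩, ⟨β, _⟩, e⟩ := e
    have e₁ : ((G ≫ A.diag.obj i ◁ p) ≫ A.diag.map a ▷ B) ≫ A.diag.map α ▷ B =
        (p ▷ W ≫ g) ≫ A.diag.map β ▷ B := e
    have e₂ : G ≫ A.diag.map a ▷ P ≫ A.diag.obj l ◁ p =
        (G ≫ A.diag.obj i ◁ p) ≫ A.diag.map a ▷ B := by
      rw [Category.assoc, whisker_exchange]
    exact ⟨m, α, β, (congrArg (· ≫ A.diag.map α ▷ B) e₂).trans e₁⟩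
  obtain ⟨m, α, β, e⟩ := key τ hτ F f hF hf
  obtain ⟨m', α', β', e'⟩ := key τ' hτ' F' f' hF' hf'
  obtain ⟨n, γ, δ, hα, hβ⟩ := IsFiltered.bowtie α α' β β'
  rw [← hf, ← hf', Germ.mk_eq_mk_iff]
  refine ⟨(n, ⟨⟨⟩⟩), (β ≫ γ, 𝟙 _), (β ≫ γ, 𝟙 _), ?_⟩
  change f ≫ A.diag.map (β ≫ γ) ▷ B = f' ≫ A.diag.map (β ≫ γ) ▷ B
  have e₁ : (F ≫ A.diag.map a ▷ P ≫ A.diag.obj l ◁ p) ≫ A.diag.map (α ≫ γ) ▷ B =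
      (p ▷ W ≫ f) ≫ A.diag.map (β ≫ γ) ▷ B := by
    rw [Functor.map_comp, Functor.map_comp, comp_whiskerRight, comp_whiskerRight,
      ← Category.assoc, e, Category.assoc]
  have e₂ : (F' ≫ A.diag.map a ▷ P ≫ A.diag.obj l ◁ p) ≫ A.diag.map (α ≫ γ) ▷ B =
      (p ▷ W ≫ f') ≫ A.diag.map (β ≫ γ) ▷ B := by
    rw [hα, hβ, Functor.map_comp, Functor.map_comp, comp_whiskerRight, comp_whiskerRight,
      ← Category.assoc, e', Category.assoc]
  refine Ban.tensor_hom_ext_of_norm_le_one fun b w hb => ?_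
  obtain ⟨ω, rfl, hω⟩ := hq' b hb
  have e₃ := DFunLike.congr_fun (congrArg Ban.Hom.clm e₁) (Ban.pure P W ω w)
  have e₄ := DFunLike.congr_fun (congrArg Ban.Hom.clm e₂) (Ban.pure P W ω w)
  simp only [Ban.comp_clm, ContinuousLinearMap.comp_apply] at e₃ e₄ ⊢
  rw [Ban.whiskerRight_pure] at e₃ e₄
  rw [← e₃, ← e₄, hω]

/-- Families of maps `N ⊗ X ⟶ A ⊗ N` natural in `N` are determined by their value at the unit. -/
theorem eq_of_natural_of_unit {A X : IndDiagram.{u} (Ban c)} (t t' : ∀ N, N ⊗ X ⟶ A ⊗ N)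
    (ht : ∀ {N N'} (f : N ⟶ N'), t N ≫ A ◁ f = f ▷ X ≫ t N')
    (ht' : ∀ {N N'} (f : N ⟶ N'), t' N ≫ A ◁ f = f ▷ X ≫ t' N')
    (h : t (𝟙_ _) = t' (𝟙_ _)) (N) : t N = t' N := by
  -- The germs of a family `s` at constant ind-objects, and their naturality.
  let τ (s : ∀ N, N ⊗ X ⟶ A ⊗ N) (x : X.Idx) (B : Ban c) :
      Germ (B ⊗ X.diag.obj x) (A ⊗ constObj B) :=
    Hom.app (X := constObj B ⊗ X) (s (constObj B)) (⟨⟨⟩⟩, x)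
  have hτ (s : ∀ N, N ⊗ X ⟶ A ⊗ N) (hs : ∀ {N N'} (f : N ⟶ N'), s N ≫ A ◁ f = f ▷ X ≫ s N')
      (x : X.Idx) {B B' : Ban c} (f : B ⟶ B') :
      Germ.post (A ◁ constDesc (Y := constObj B') ⟨⟨⟩⟩ f) (τ s x B) =
        (τ s x B').pre (f ▷ X.diag.obj x) :=
    (congrArg (fun g => Hom.app (X := constObj B ⊗ X) g (⟨⟨⟩⟩, x))
      (hs (constDesc (Y := constObj B') ⟨⟨⟩⟩ f))).trans (whiskerRight_constDesc_comp_app _ _ _ _ _)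
  have hconst (x : X.Idx) (B : Ban c) : τ t x B = τ t' x B :=
    germ_eq_of_natural_of_unit (τ t x) (τ t' x) (hτ t ht x) (hτ t' ht' x)
      (congrArg (fun g => Hom.app (X := unitObj ⊗ X) g (⟨⟨⟩⟩, x)) h) B
  refine hom_ext (X := N ⊗ X) fun ⟨i, x⟩ => ?_
  have restrict : ∀ s : N ⊗ X ⟶ A ⊗ N, Hom.app (X := N ⊗ X) s (i, x) =
      Hom.app (X := constObj (N.diag.obj i) ⊗ X)
        (constDesc (Y := N) i (𝟙 (N.diag.obj i)) ▷ X ≫ s) (⟨⟨⟩⟩, x) := fun s => by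
    rw [whiskerRight_constDesc_comp_app, id_whiskerRight]
    exact (Germ.pre_id _).symm
  rw [restrict, restrict, ← ht, ← ht']
  exact congrArg (Germ.post (A ◁ constDesc (Y := N) i (𝟙 _))) (hconst x (N.diag.obj i))

end IndDiagram

/-! ### The algebra of internal endomorphisms of the forgetful functor -/

theorem proposition3p10 {k : Type u} [NontriviallyNormedField k] [CompleteSpace k]
    (c : BanachConvention k) (A : IndBan c) [MonObj A] :
    ∃ (_ : HasEnd (internalNatDiagram (Mod.forget (D := IndBan c) A) (Mod.forget A)))
      (e : A ≅ InternalNat (Mod.forget (D := IndBan c) A) (Mod.forget A)),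
      IsMonHom e.hom ∧
        ∀ M : Mod (IndBan c) A,
          e.hom ≫ InternalNat.π (Mod.forget A) (Mod.forget A) M = actionMap A M := by
  have hA (X : IndBan c) := fun t t' ht ht' h =>
    IndDiagram.eq_of_natural_of_unit (A := A) (X := X) t t' ht ht' h
  let D := internalNatDiagram (Mod.forget (D := IndBan c) A) (Mod.forget A)
  let W : Wedge D := Wedge.mk (F := D) A (actionMap A) fun _ _ a => actionMap_natural A a
  -- A wedge is determined by its component at the regular module, evaluated at the unit of `A`.
  have hW : IsLimit W := Multifork.IsLimit.mk _
    (fun s => evalOne (A := A) (MonoidalClosed.uncurry (s.ι (Mod.regular A))))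
    (fun s M => evalOne_comp_actionMap (hA _) s.ι (fun a => Wedge.condition s a) M)
    (fun s m hm => (evalOne_actionMap (A := A) m).symm.trans
      (congrArg (fun g => evalOne (A := A) (MonoidalClosed.uncurry g)) (hm (Mod.regular A))))
  have hD : HasEnd D := ⟨⟨W, hW⟩⟩
  let e : A ≅ InternalNat (Mod.forget (D := IndBan c) A) (Mod.forget A) :=
    hW.conePointUniqueUpToIso (limit.isLimit _)
  have he (M : Mod (IndBan c) A) :
      e.hom ≫ InternalNat.π (Mod.forget A) (Mod.forget A) M = actionMap A M :=
    hW.conePointUniqueUpToIso_hom_comp (limit.isLimit _) (WalkingMulticospan.left M)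
  refine ⟨hD, e, ⟨InternalNat.hom_ext fun M => ?_, InternalNat.hom_ext fun M => ?_⟩, he⟩
  · exact (Category.assoc _ _ _).trans ((congrArg (MonObj.one (X := A) ≫ ·) (he M)).trans
      ((one_actionMap A M).trans (InternalNat.one_π (Mod.forget A) M).symm))
  · have h : (e.hom ⊗ₘ e.hom) ≫ (InternalNat.π (Mod.forget A) (Mod.forget A) M ⊗ₘ
        InternalNat.π (Mod.forget A) (Mod.forget A) M) = actionMap A M ⊗ₘ actionMap A M :=
      (MonoidalCategory.tensorHom_comp_tensorHom _ _ _ _).trans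
        (congrArg₂ (fun f g => f ⊗ₘ g) (he M) (he M))
    refine (Category.assoc _ _ _).trans ((congrArg (MonObj.mul (X := A) ≫ ·) (he M)).trans
      ((mul_actionMap A M).trans ?_))
    refine Eq.trans ?_ ((congrArg ((e.hom ⊗ₘ e.hom) ≫ ·) (InternalNat.mul_π _ M)).symm.trans
      (Category.assoc _ _ _).symm)
    exact (congrArg (· ≫ (β_ _ _).hom ≫ MonoidalClosed.comp M.X M.X M.X) h).symm.trans
      (Category.assoc _ _ _)
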